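/- Let $n\ge 1$ be an integer. Write $\gamma(t,x)=\int_0^x s^{t-1}e^{-s}\,ds$, $\operatorname{erf}(t)=\frac{2}{\sqrt\pi}\int_0^t e^{-s^2}\,ds$, and let $\Phi_{\mathbb R^n}\colon(0,1)^n\to\mathbb R^n$ be the map $(x_1,\dots,x_n)\mapsto(\sqrt2\operatorname{erf}^{-1}(2x_1-1),\dots,\sqrt2\operatorname{erf}^{-1}(2x_n-1))$. Let $\mu_1$ be the standard Gaussian measure on $\mathbb R^n$, with density $(2\pi)^{-n/2}e^{-\|x\|^2/2}$. Let $\mathbb{RP}^n$ carry its standard Riemannian metric (for which the double covering $\mathbb S^n\to\mathbb{RP}^n$ is a local isometry); its volume is $V=\pi^{(n+1)/2}/\Gamma(\frac{n+1}{2})$, and $\mathrm{unif}$ denotes the Riemannian volume divided by $V$. Points of $\mathbb{RP}^n$ are written in homogeneous coordinates $(u,1)$, $u\in\mathbb R^n$, off the hyperplane $\mathcal X=\{x_{n+1}=0\}$, and $\exp_{\mathbb{RP}^n}(v)=\big(\frac{v}{\|v\|}\tan\|v\|,1\big)$ for $\|v\|<\pi/2$. Let $\mu_\omega$ be the measure on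 the open ball $B^n(0,\pi/2)$ with density $\omega(\|x\|)$, where $$\omega(r)=\frac{\Gamma(\frac{n+1}{2})}{\pi^{(n+1)/2}}\,\frac{\sin^{n-1}r}{r^{n-1}}.$$ Expressions of the form $\frac{x}{\|x\|}f(\|x\|)$ are understood to be $0$ at $x=0$. A bijection between measure spaces is called measure preserving if it and its inverse are measurable and it carries the first measure to the second. (a) For every $r\ge0$ there is a unique $\rho=\rho(r)\in[0,\pi/2)$ with $$\int_0^{\rho}\sin^{n-1}t\,dt=\frac{\sqrt\pi}{2\,\Gamma(\frac{n+1}{2})}\,\gamma\Big(\frac n2,\frac{r^2}{2}\Big).$$ With this $\rho$, the map $\varphi_{\mathbb{RP}^n}(x)=x\,\rho(\|x\|)/\|x\|$ is a measure-preserving bijection from $(\mathbb R^n,\mu_1)$ onto $(B^n(0,\pi/2),\mu_\omega)$. Consequently $\Phi_{\mathbb{RP}^n}=\exp_{\mathbb{RP}^n}\circ\varphi_{\mathbb{RP}^n}\circ\Phi_{\mathbb R^n}$ is a measure-preserving map from $((0,1)^n,\mathrm{unif})$ to $(\mathbb{RP}^n,\mathrm{unif})$; it is a bijection, measurable with measurable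 inverse, onto $\mathbb{RP}^n\setminus\mathcal X$, and $\mathcal X$ has measure zero. (b) For $n=1$, for all $r\ge 0$, $\rho(r)=\frac{\sqrt\pi}{2}\gamma\big(\frac12,\frac{r^2}{2}\big)=\frac\pi2\operatorname{erf}\big(\frac{r}{\sqrt2}\big)$, and $\Phi_{\mathbb{RP}^1}(x)=(-\cot\pi x,1)$ for all $x\in(0,1)$. (c) For $n=2$, for all $r\ge 0$, $\rho(r)=\arccos e^{-r^2/2}$, and for all $x\in(0,1)^2$, $$\Phi_{\mathbb{RP}^2}(x)=\bigg(\frac{\Phi_{\mathbb R^2}(x)}{\|\Phi_{\mathbb R^2}(x)\|}\sqrt{e^{\|\Phi_{\mathbb R^2}(x)\|^2}-1},\,1\bigg).$$ -/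

import Mathlib

open MeasureTheory Set
open scoped ENNReal LinearAlgebra.Projectivization

noncomputable section

/-- The lower incomplete gamma function `γ(t, x) = ∫₀ˣ s^(t-1) e^(-s) ds`. -/
def incGamma (t x : ℝ) : ℝ := ∫ s in (0 : ℝ)..x, s ^ (t - 1) * Real.exp (-s)

/-- The error function. -/
def erf (t : ℝ) : ℝ := 2 / √Real.pi * ∫ s in (0 : ℝ)..t, Real.exp (-s ^ 2)

/-- The inverse of the error function, defined on its range `(-1, 1)`. -/
def erfInv : ℝ → ℝ := Function.invFun erf

/-- The open unit cube `(0,1)ⁿ`. -/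
def unitCube (n : ℕ) : Set (EuclideanSpace ℝ (Fin n)) := {x | ∀ i, x i ∈ Ioo (0 : ℝ) 1}

/-- Lebesgue measure on the open unit cube, as a measure on the subtype (its total mass is 1). -/
def cubeUnif (n : ℕ) : Measure (unitCube n) := Measure.comap Subtype.val volume

/-- The map from the unit cube to `ℝⁿ`, with coordinates `√2 erf⁻¹(2 xᵢ - 1)`. -/
def cubeToEuclidean (n : ℕ) (x : unitCube n) : EuclideanSpace ℝ (Fin n) :=
  WithLp.toLp 2 fun i => √2 * erfInv (2 * x.1 i - 1)

/-- The centred Gaussian measure on `ℝⁿ` with covariance `c` times the identity. -/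
def gaussianEuclidean (n : ℕ) (c : ℝ) : Measure (EuclideanSpace ℝ (Fin n)) :=
  volume.withDensity fun x =>
    ENNReal.ofReal (1 / (2 * Real.pi * c) ^ ((n : ℝ) / 2) * Real.exp (-‖x‖ ^ 2 / (2 * c)))

/-- The measure on the open ball `B(0, R)` with density `ω(‖x‖)` (as a measure on `ℝⁿ` that
vanishes outside the ball). -/
def radialMeasure (n : ℕ) (R : ℝ) (ω : ℝ → ℝ) : Measure (EuclideanSpace ℝ (Fin n)) :=
  (volume.restrict (Metric.ball 0 R)).withDensity fun x => ENNReal.ofReal (ω ‖x‖)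

/-- The real projective space `ℝPⁿ`: the lines through the origin of `ℝⁿ⁺¹`. -/
abbrev RP (n : ℕ) : Type := ℙ ℝ (EuclideanSpace ℝ (Fin (n + 1)))

/-- The quotient topology of `ℝⁿ⁺¹ \ {0}`. -/
instance RP.instTopologicalSpace (n : ℕ) : TopologicalSpace (RP n) :=
  TopologicalSpace.coinduced
    (fun v : {v : EuclideanSpace ℝ (Fin (n + 1)) // v ≠ 0} => Projectivization.mk ℝ v.1 v.2)
    inferInstance

instance RP.instMeasurableSpace (n : ℕ) : MeasurableSpace (RP n) := borel (RP n)

instance RP.instBorelSpace (n : ℕ) : BorelSpace (RP n) := ⟨rfl⟩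

namespace RP

variable {n : ℕ}

/-- The vector of `ℝⁿ⁺¹` obtained from `u ∈ ℝⁿ` by inserting the coordinate `1` at position `i`. -/
def homog (i : Fin (n + 1)) (u : EuclideanSpace ℝ (Fin n)) : EuclideanSpace ℝ (Fin (n + 1)) :=
  WithLp.toLp 2 (i.insertNth (α := fun _ => ℝ) 1 fun j => u j)

theorem homog_ne_zero (i : Fin (n + 1)) (u : EuclideanSpace ℝ (Fin n)) : homog i u ≠ 0 := by
  intro h
  have h1 : homog i u i = 0 := by rw [h]; rfl
  simp [homog] at h1

/-- The inverse of the `i`-th affine chart: `u` is sent to the point with homogeneous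
coordinates `[u₁ : … : 1 : … : uₙ]`, the `1` being at position `i`. -/
def ofChart (i : Fin (n + 1)) (u : EuclideanSpace ℝ (Fin n)) : RP n :=
  Projectivization.mk ℝ (homog i u) (homog_ne_zero i u)

/-- The point of `ℝPⁿ` with homogeneous coordinates `(u, 1)`. -/
def affine (u : EuclideanSpace ℝ (Fin n)) : RP n := ofChart (Fin.last n) u

/-- The lift of the inverse chart `ofChart i` to the unit sphere of `ℝⁿ⁺¹`. -/
def sphereLift (i : Fin (n + 1)) (u : EuclideanSpace ℝ (Fin n)) :
    EuclideanSpace ℝ (Fin (n + 1)) := ‖homog i u‖⁻¹ • homog i u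

/-- The Gram matrix, in the `i`-th affine chart, of the standard Riemannian metric of `ℝPⁿ`: the
metric for which the double covering by the unit sphere is a local isometry. -/
def metric (i : Fin (n + 1)) (u : EuclideanSpace ℝ (Fin n)) : Matrix (Fin n) (Fin n) ℝ :=
  Matrix.of fun j k => inner ℝ
    (fderiv ℝ (sphereLift i) u (EuclideanSpace.single j 1))
    (fderiv ℝ (sphereLift i) u (EuclideanSpace.single k 1))

/-- The set of points whose last nonzero homogeneous coordinate is the `i`-th one. These sets
partition `ℝPⁿ`, and the `i`-th one lies in the domain of the `i`-th affine chart. -/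
def cell (i : Fin (n + 1)) : Set (RP n) := {p | p.rep i ≠ 0 ∧ ∀ j, i < j → p.rep j = 0}

/-- The Riemannian volume of `ℝPⁿ`: it has density `√det g` in the affine charts. The partition
into the sets `cell i` ensures that each point is counted in exactly one chart. -/
def riemannianVolume (n : ℕ) : Measure (RP n) :=
  ∑ i : Fin (n + 1),
    ((volume.withDensity fun u => ENNReal.ofReal √(metric i u).det).map (ofChart i)).restrict
      (cell i)

/-- The uniform probability measure: the Riemannian volume divided by the total volume. -/
def unif (n : ℕ) : Measure (RP n) := (riemannianVolume n univ)⁻¹ • riemannianVolume n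

/-- The hyperplane at infinity `{x_{n+1} = 0}`. -/
def hyperplane (n : ℕ) : Set (RP n) := {p | p.rep (Fin.last n) = 0}

/-- The Riemannian exponential map of `ℝPⁿ` at `[0 : … : 0 : 1]`, on the ball `B(0, π/2)`:
`v` is sent to `((v / ‖v‖) tan ‖v‖, 1)` in homogeneous coordinates, and `0` to `(0, 1)`. -/
def exp (v : EuclideanSpace ℝ (Fin n)) : RP n := affine ((Real.tan ‖v‖ / ‖v‖) • v)

/-- The volume density of `ℝPⁿ` (that is, the Jacobian of `exp` at distance `r` from the origin)
divided by the volume `π^((n+1)/2) / Γ((n+1)/2)` of `ℝPⁿ`. -/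
def weight (n : ℕ) (r : ℝ) : ℝ :=
  Real.Gamma (((n : ℝ) + 1) / 2) / Real.pi ^ (((n : ℝ) + 1) / 2) *
    (Real.sin r ^ (n - 1) / r ^ (n - 1))

/-- `s ∈ [0, π/2)` solves the equation that determines the value `s = ρ(r)`. -/
def IsRadius (n : ℕ) (r s : ℝ) : Prop :=
  s ∈ Ico 0 (Real.pi / 2) ∧
    ∫ t in (0 : ℝ)..s, Real.sin t ^ (n - 1) =
      √Real.pi / (2 * Real.Gamma (((n : ℝ) + 1) / 2)) * incGamma ((n : ℝ) / 2) (r ^ 2 / 2)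

/-- The radial map `x ↦ x ρ(‖x‖) / ‖x‖` (with value `0` at `0`). -/
def radialMap (ρ : ℝ → ℝ) (x : EuclideanSpace ℝ (Fin n)) : EuclideanSpace ℝ (Fin n) :=
  (ρ ‖x‖ / ‖x‖) • x

/-- The composition of `exp`, the radial map, and the map from the cube to `ℝⁿ`. -/
def cubeMap (n : ℕ) (ρ : ℝ → ℝ) (x : unitCube n) : RP n :=
  exp (radialMap ρ (cubeToEuclidean n x))

end RP

end

/-! Every map here is a bijection whose transport of measure reduces to one variable. If `F` and `G`
are primitives of densities `w` and `v`, then `G ∘ f = F` forces `f` to carry `w` to `v`: both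
measures are computed as lengths of the same image set (`map_withDensity_of_primitive`). On each
coordinate this sends the uniform law to the normal law. In polar coordinates
(`map_radialMap_withDensity`) it handles all radial maps, and the equation defining `ρ` is, up to a
constant, exactly `G (ρ r) = F r` for the radial Gaussian and spherical densities.

For `ℝPⁿ`, the Gram determinant in an affine chart is `(1 + ‖u‖²)^(-(n+1))`, and the hyperplane at
infinity is null, so the volume lives in one chart (`riemannianVolume_eq`). There `exp ∘ φ` is the
radial map with profile `tan ∘ ρ`, and the substitution `s = arctan t` turns `sin^(n-1)` into the
radial density of that volume (`map_radialMap_tan_radius`). Hence the cube is carried to a constant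
multiple of the Riemannian volume. Since the cube has mass 1, this also yields the total volume of
`ℝPⁿ`, with no separate integration.

Bijectivity comes from monotonicity and the intermediate value theorem: Wallis' integral of
`sin^(n-1)` over `[0, π/2]` is the limit of the right side of the equation as `r → ∞`, so `ρ` fills
`[0, π/2)`. Measurable inverses come from Lusin–Souslin on Euclidean spaces and from openness of the
affine chart. -/

/-- Transport of measures on the line through primitives of their densities. -/
theorem map_withDensity_of_primitive {S T : Set ℝ} {f F G w v : ℝ → ℝ}
    (hS : MeasurableSet S) (hT : MeasurableSet T) (hf : Measurable f)
    (hfT : f '' S = T)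
    (hF : ∀ x ∈ S, HasDerivAt F (w x) x) (hG : ∀ y ∈ T, HasDerivAt G (v y) y)
    (hw : ∀ x ∈ S, 0 ≤ w x) (hv : ∀ y ∈ T, 0 ≤ v y)
    (hFi : InjOn F S) (hGi : InjOn G T) (hFG : ∀ x ∈ S, G (f x) = F x) :
    ((volume.restrict S).withDensity fun x => ENNReal.ofReal (w x)).map f =
      (volume.restrict T).withDensity fun y => ENNReal.ofReal (v y) := by
  -- Change of variables with integrand 1: the mass of a set is the length of its image under the
  -- primitive. Nothing but measurability is asked of `f` itself.
  have key : ∀ {U : Set ℝ} {H u : ℝ → ℝ} (_ : MeasurableSet U)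
      (_ : ∀ x ∈ U, HasDerivAt H (u x) x) (_ : ∀ x ∈ U, 0 ≤ u x) (_ : InjOn H U)
      {B : Set ℝ} (_ : MeasurableSet B),
      ((volume.restrict U).withDensity fun x => ENNReal.ofReal (u x)) B =
        volume (H '' (B ∩ U)) := by
    intro U H u hU hH hu hi B hB
    rw [withDensity_apply _ hB, Measure.restrict_restrict hB]
    have := lintegral_image_eq_lintegral_abs_deriv_mul (hB.inter hU)
      (fun x hx => (hH x hx.2).hasDerivWithinAt) (hi.mono inter_subset_right) 1
    simp only [Pi.one_apply, lintegral_one, mul_one, Measure.restrict_apply_univ] at this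
    rw [this]
    refine setLIntegral_congr_fun (hB.inter hU) fun x hx => ?_
    simp only [abs_of_nonneg (hu x hx.2)]
  ext A hA
  rw [Measure.map_apply hf hA, key hS hF hw hFi (hf hA), key hT hG hv hGi hA]
  congr 1
  -- As `T = f '' S`, the set `A ∩ T` is the `f`-image of `S ∩ f⁻¹ A`, so `G` maps it to what `F`
  -- makes of `S ∩ f⁻¹ A`.
  rw [← hfT, inter_comm A, ← image_inter_preimage, image_image, inter_comm]
  exact image_congr fun x hx => (hFG x hx.1).symm

/-! ### Polar coordinates and radial maps -/

section Polar

variable {E : Type*} [NormedAddCommGroup E] [NormedSpace ℝ E] [FiniteDimensional ℝ E]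
  [MeasurableSpace E] [BorelSpace E] [Nontrivial E]

theorem lintegral_eq_lintegral_toSphere (μ : Measure E) [μ.IsAddHaarMeasure] {g : E → ℝ≥0∞}
    (hg : Measurable g) :
    ∫⁻ x, g x ∂μ = ∫⁻ s, ∫⁻ r in Ioi (0 : ℝ),
      ENNReal.ofReal (r ^ (Module.finrank ℝ E - 1)) * g (r • s.1) ∂volume ∂μ.toSphere := by
  have h0 : ∫⁻ x, g x ∂μ = ∫⁻ x : ({0}ᶜ : Set E), g x ∂(μ.comap (↑)) := by
    rw [lintegral_subtype_comap (measurableSet_singleton _).compl, restrict_compl_singleton]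
  have h1 := μ.measurePreserving_homeomorphUnitSphereProd.lintegral_comp_emb
    (Homeomorph.measurableEmbedding _) (fun p => g (p.2.1 • p.1.1))
  have hm : Measurable fun p : Metric.sphere (0 : E) 1 × Ioi (0 : ℝ) => g (p.2.1 • p.1.1) :=
    hg.comp (by fun_prop)
  have h2 : ∀ x : ({0}ᶜ : Set E), g ((homeomorphUnitSphereProd E x).2.1 •
      (homeomorphUnitSphereProd E x).1.1) = g x := by
    intro x
    have : ‖x.1‖ ≠ 0 := norm_ne_zero_iff.2 x.2
    simp [smul_smul, this]
  simp only [h2] at h1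
  rw [h0, h1, lintegral_prod _ hm.aemeasurable]
  refine lintegral_congr fun s => ?_
  have hms : Measurable fun r : Ioi (0 : ℝ) => g (r.1 • s.1) := hg.comp (by fun_prop)
  rw [Measure.volumeIoiPow, lintegral_withDensity_eq_lintegral_mul _ (by fun_prop) hms]
  exact lintegral_subtype_comap measurableSet_Ioi
    (fun r : ℝ => ENNReal.ofReal (r ^ (Module.finrank ℝ E - 1)) * g (r • s.1))

end Polar

namespace RP

variable {n : ℕ}

theorem measurable_radialMap {f : ℝ → ℝ} (hf : Measurable f) :
    Measurable (radialMap (n := n) f) := by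
  unfold radialMap
  fun_prop

/-- On the ray through a unit vector `s` the map is `r • s ↦ f r • s`, so after integrating a test
function in polar coordinates each ray gives the same one-dimensional statement `h`. -/
theorem map_radialMap_withDensity (hn : 0 < n) {f : ℝ → ℝ} (hf : Measurable f) {w v : ℝ → ℝ≥0∞}
    (hw : Measurable w) (hv : Measurable v)
    (h : ((volume.restrict (Ioi 0)).withDensity
        fun r => ENNReal.ofReal (r ^ (n - 1)) * w r).map f =
      (volume.restrict (Ioi 0)).withDensity fun r => ENNReal.ofReal (r ^ (n - 1)) * v r) :
    (volume.withDensity fun x : EuclideanSpace ℝ (Fin n) => w ‖x‖).map (radialMap f) =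
      volume.withDensity fun x => v ‖x‖ := by
  have : Nonempty (Fin n) := ⟨⟨0, hn⟩⟩
  have hmap := measurable_radialMap (n := n) hf
  refine Measure.ext_of_lintegral _ fun g hg => ?_
  have hgr : Measurable fun x => g (radialMap f x) := hg.comp hmap
  rw [lintegral_map hg hmap, lintegral_withDensity_eq_lintegral_mul _ (by fun_prop) hgr,
    lintegral_withDensity_eq_lintegral_mul _ (by fun_prop) hg,
    lintegral_eq_lintegral_toSphere (E := EuclideanSpace ℝ (Fin n)) volume (by fun_prop),
    lintegral_eq_lintegral_toSphere (E := EuclideanSpace ℝ (Fin n)) volume (by fun_prop)]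
  refine lintegral_congr fun s => ?_
  have hs : ‖s.1‖ = 1 := norm_eq_of_mem_sphere s
  simp only [finrank_euclideanSpace, Fintype.card_fin, Pi.mul_apply]
  have hgs : Measurable fun r : ℝ => g (r • s.1) := hg.comp (by fun_prop)
  calc
    _ = ∫⁻ r in Ioi (0 : ℝ), (ENNReal.ofReal (r ^ (n - 1)) * w r) * g (f r • s.1) := by
      refine setLIntegral_congr_fun measurableSet_Ioi fun r hr => ?_
      have hr' : 0 < r := hr
      simp only [radialMap, norm_smul, hs, Real.norm_eq_abs, abs_of_pos hr', mul_one, smul_smul,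
        div_mul_cancel₀ _ hr'.ne', mul_assoc]
    _ = ∫⁻ r, g (r • s.1) ∂((volume.restrict (Ioi 0)).withDensity
        fun r => ENNReal.ofReal (r ^ (n - 1)) * w r).map f := by
      have hgf : Measurable fun r => g (f r • s.1) := hgs.comp hf
      rw [lintegral_map hgs hf, lintegral_withDensity_eq_lintegral_mul _ (by fun_prop) hgf]
      rfl
    _ = _ := by
      rw [h, lintegral_withDensity_eq_lintegral_mul _ (by fun_prop) hgs]
      refine setLIntegral_congr_fun measurableSet_Ioi fun r hr => ?_
      have hr' : 0 < r := hr
      simp only [Pi.mul_apply, norm_smul, hs, Real.norm_eq_abs, abs_of_pos hr', mul_one, mul_assoc]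

end RP

/-! ### The error function and the normal quantile -/

theorem continuous_exp_neg_sq : Continuous fun s : ℝ => Real.exp (-s ^ 2) := by fun_prop

theorem hasDerivAt_erf (t : ℝ) : HasDerivAt erf (2 / √Real.pi * Real.exp (-t ^ 2)) t :=
  (continuous_exp_neg_sq.integral_hasStrictDerivAt 0 t).hasDerivAt.const_mul _

theorem continuous_erf : Continuous erf :=
  continuous_iff_continuousAt.2 fun t => (hasDerivAt_erf t).continuousAt

theorem strictMono_erf : StrictMono erf :=
  strictMono_of_hasDerivAt_pos hasDerivAt_erf fun t => by positivity

theorem erf_neg (t : ℝ) : erf (-t) = -erf t := by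
  have h := intervalIntegral.integral_comp_neg (a := 0) (b := t) fun s : ℝ => Real.exp (-s ^ 2)
  simp only [neg_sq, neg_zero] at h
  rw [erf, erf, h, intervalIntegral.integral_symm 0 (-t)]
  ring

theorem tendsto_erf_atTop : Filter.Tendsto erf Filter.atTop (nhds 1) := by
  have hi : IntegrableOn (fun s : ℝ => Real.exp (-s ^ 2)) (Ioi 0) := by
    simpa using (integrable_exp_neg_mul_sq one_pos).integrableOn (s := Ioi (0 : ℝ))
  have h := (intervalIntegral_tendsto_integral_Ioi 0 hi Filter.tendsto_id).const_mul (2 / √Real.pi)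
  have hv : ∫ s in Ioi (0 : ℝ), Real.exp (-s ^ 2) = √Real.pi / 2 := by
    simpa using integral_gaussian_Ioi 1
  have hp : √Real.pi ≠ 0 := by positivity
  rw [hv, show 2 / √Real.pi * (√Real.pi / 2) = 1 by field_simp] at h
  exact h

theorem erf_lt_one (t : ℝ) : erf t < 1 :=
  (strictMono_erf (lt_add_one t)).trans_le
    (strictMono_erf.monotone.ge_of_tendsto tendsto_erf_atTop _)

theorem range_erf : range erf = Ioo (-1) 1 := by
  refine Subset.antisymm ?_ fun y hy => ?_
  · rintro _ ⟨t, rfl⟩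
    exact ⟨by linarith [erf_lt_one (-t), erf_neg t], erf_lt_one t⟩
  · obtain ⟨b, hb⟩ := (tendsto_erf_atTop.eventually (eventually_gt_nhds hy.2)).exists
    obtain ⟨a, ha⟩ := (tendsto_erf_atTop.eventually
      (eventually_gt_nhds (show -y < 1 by linarith [hy.1]))).exists
    exact mem_range_of_exists_le_of_exists_ge continuous_erf
      ⟨-a, by rw [erf_neg]; linarith⟩ ⟨b, hb.le⟩

theorem erfInv_erf (t : ℝ) : erfInv (erf t) = t :=
  Function.leftInverse_invFun strictMono_erf.injective t

theorem erf_erfInv {y : ℝ} (hy : y ∈ Ioo (-1 : ℝ) 1) : erf (erfInv y) = y :=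
  Function.invFun_eq (range_erf.symm ▸ hy : y ∈ range erf)

theorem measurable_erfInv : Measurable erfInv := by
  -- Off its range the inverse is a constant junk value, so it extends the identity along the
  -- measurable embedding `erf`.
  have h : erfInv = Function.extend erf id fun _ => Classical.arbitrary ℝ := by
    funext y
    rfl
  rw [h]
  exact (continuous_erf.measurableEmbedding strictMono_erf.injective).measurable_extend
    measurable_id measurable_const

/-- The quantile function of the standard normal distribution. -/
noncomputable def normalQuantile (x : ℝ) : ℝ := √2 * erfInv (2 * x - 1)

theorem measurable_normalQuantile : Measurable normalQuantile := by
  unfold normalQuantile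
  exact (measurable_erfInv.comp (by fun_prop)).const_mul _

theorem erf_normalQuantile {x : ℝ} (hx : x ∈ Ioo (0 : ℝ) 1) :
    erf (normalQuantile x / √2) = 2 * x - 1 := by
  rw [normalQuantile, mul_div_cancel_left₀ _ (by positivity), erf_erfInv]
  constructor <;> linarith [hx.1, hx.2]

theorem injOn_normalQuantile : InjOn normalQuantile (Ioo 0 1) := fun x hx y hy h => by
  linarith [erf_normalQuantile hx, erf_normalQuantile hy, congrArg (fun t => erf (t / √2)) h]

theorem exists_normalQuantile_eq (y : ℝ) : ∃ x ∈ Ioo (0 : ℝ) 1, normalQuantile x = y := by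
  have h : erf (y / √2) ∈ Ioo (-1 : ℝ) 1 := range_erf ▸ mem_range_self _
  refine ⟨(1 + erf (y / √2)) / 2, ⟨by linarith [h.1], by linarith [h.2]⟩, ?_⟩
  rw [normalQuantile, show 2 * ((1 + erf (y / √2)) / 2) - 1 = erf (y / √2) by ring, erfInv_erf,
    mul_div_cancel₀ _ (by positivity)]

open ProbabilityTheory in
theorem hasDerivAt_normalCDF (y : ℝ) :
    HasDerivAt (fun y => (1 + erf (y / √2)) / 2) (gaussianPDFReal 0 1 y) y := by
  have h := (((hasDerivAt_erf (y / √2)).comp y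
    ((hasDerivAt_id y).div_const (√2))).const_add 1).div_const 2
  convert! h using 1
  have h2 : √(2 * Real.pi) = √2 * √Real.pi := Real.sqrt_mul (by norm_num) _
  simp only [gaussianPDFReal, NNReal.coe_one, mul_one, sub_zero, div_pow, h2, neg_div]
  rw [Real.sq_sqrt (by norm_num)]
  field_simp

-- The one-variable transport principle with the identity as primitive on the cube side and the
-- normal distribution function on the other.
open ProbabilityTheory in
theorem measurePreserving_normalQuantile :
    MeasurePreserving normalQuantile (volume.restrict (Ioo 0 1)) (gaussianReal 0 1) := by
  refine ⟨measurable_normalQuantile, ?_⟩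
  have h := map_withDensity_of_primitive (S := Ioo 0 1) (T := univ) (f := normalQuantile)
    (F := fun x => x) (G := fun y => (1 + erf (y / √2)) / 2) (w := fun _ => 1)
    (v := gaussianPDFReal 0 1) measurableSet_Ioo .univ measurable_normalQuantile
    (eq_univ_of_forall exists_normalQuantile_eq) (fun x _ => hasDerivAt_id' x)
    (fun y _ => hasDerivAt_normalCDF y) (fun _ _ => zero_le_one)
    (fun y _ => gaussianPDFReal_nonneg 0 1 y) (fun _ _ _ _ h => h)
    (fun x _ y _ h => by
      have h' : erf (x / √2) = erf (y / √2) := by simpa using h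
      exact (div_left_inj' (by positivity)).1 (strictMono_erf.injective h'))
    (fun x hx => by rw [erf_normalQuantile hx]; ring)
  simp only [ENNReal.ofReal_one, Measure.restrict_univ] at h
  rw [show (fun _ : ℝ => (1 : ℝ≥0∞)) = 1 from rfl, withDensity_one] at h
  rw [h, gaussianReal_of_var_ne_zero 0 one_ne_zero]
  rfl

/-! ### From the unit cube to Gaussian space -/

open ProbabilityTheory in
theorem map_toLp_pi_gaussianReal (n : ℕ) :
    (Measure.pi fun _ : Fin n => gaussianReal 0 1).map (WithLp.toLp 2) =
      gaussianEuclidean n 1 := by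
  have hpi : (Measure.pi fun _ : Fin n => gaussianReal 0 1) =
      volume.withDensity fun x => ENNReal.ofReal (∏ i, gaussianPDFReal 0 1 (x i)) := by
    refine Measure.pi_eq fun s hs => ?_
    have hint : ∀ i : Fin n, Integrable (gaussianPDFReal 0 1) (volume.restrict (s i)) := fun i =>
      (integrable_gaussianPDFReal 0 1).restrict
    rw [withDensity_apply _ (MeasurableSet.univ_pi hs), volume_pi, Measure.restrict_pi_pi,
      ← ofReal_integral_eq_lintegral_ofReal (.fintype_prod_dep hint)
        (ae_of_all _ fun x => Finset.prod_nonneg fun i _ => gaussianPDFReal_nonneg 0 1 _),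
      integral_fintype_prod_eq_prod, ENNReal.ofReal_prod_of_nonneg fun i _ =>
        integral_nonneg fun x => gaussianPDFReal_nonneg 0 1 x]
    refine Finset.prod_congr rfl fun i _ => ?_
    rw [gaussianReal_apply_eq_integral 0 one_ne_zero]
  have hpdf : ∀ x : EuclideanSpace ℝ (Fin n), ∏ i, gaussianPDFReal 0 1 (x i) =
      1 / (2 * Real.pi * 1) ^ ((n : ℝ) / 2) * Real.exp (-‖x‖ ^ 2 / (2 * 1)) := by
    intro x
    simp only [gaussianPDFReal, NNReal.coe_one, mul_one, sub_zero, Finset.prod_mul_distrib,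
      Finset.prod_const, Finset.card_univ, Fintype.card_fin, ← Real.exp_sum,
      EuclideanSpace.real_norm_sq_eq, neg_div, Finset.sum_neg_distrib, Finset.sum_div]
    rw [Real.sqrt_eq_rpow, ← Real.rpow_neg (by positivity), ← Real.rpow_natCast,
      ← Real.rpow_mul (by positivity), one_div (_ ^ _),
      ← Real.rpow_neg (x := 2 * Real.pi) (by positivity)]
    ring_nf
  have he := (PiLp.volume_preserving_toLp (Fin n))
  rw [hpi, gaussianEuclidean]
  ext A hA
  rw [Measure.map_apply he.measurable hA, withDensity_apply _ hA,
    withDensity_apply _ (he.measurable hA), ← he.map_eq,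
    setLIntegral_map hA (by fun_prop) he.measurable]
  refine lintegral_congr fun x => ?_
  rw [← hpdf]

theorem measurableSet_unitCube (n : ℕ) : MeasurableSet (unitCube n) := by
  have : unitCube n = ⋂ i, (fun x : EuclideanSpace ℝ (Fin n) => x i) ⁻¹' Ioo 0 1 := by
    ext; simp [unitCube]
  rw [this]
  exact .iInter fun i => measurableSet_Ioo.preimage (by fun_prop)

theorem cubeToEuclidean_apply {n : ℕ} (x : unitCube n) (i : Fin n) :
    cubeToEuclidean n x i = normalQuantile (x.1 i) := rfl

theorem measurePreserving_cubeToEuclidean (n : ℕ) :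
    MeasurePreserving (cubeToEuclidean n) (cubeUnif n) (gaussianEuclidean n 1) := by
  let q : (Fin n → ℝ) → Fin n → ℝ := fun a i => normalQuantile (a i)
  have hq : Measurable q := measurable_pi_lambda _ fun i =>
    measurable_normalQuantile.comp (measurable_pi_apply i)
  have h1 : MeasurePreserving q _ _ := measurePreserving_pi
    (fun _ : Fin n => volume.restrict (Ioo 0 1)) _ fun _ => measurePreserving_normalQuantile
  have hof := PiLp.volume_preserving_ofLp (Fin n)
  have hc : MeasurePreserving (Subtype.val : unitCube n → _) (cubeUnif n)
      (volume.restrict (unitCube n)) :=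
    ⟨measurable_subtype_coe, map_comap_subtype_coe (measurableSet_unitCube n) volume⟩
  have h2 : MeasurePreserving (WithLp.ofLp : EuclideanSpace ℝ (Fin n) → _)
      (volume.restrict (unitCube n))
      (Measure.pi fun _ : Fin n => volume.restrict (Ioo (0 : ℝ) 1)) := by
    rw [← Measure.restrict_pi_pi]
    have hcube : unitCube n = WithLp.ofLp ⁻¹' univ.pi fun _ : Fin n => Ioo (0 : ℝ) 1 := by
      ext x
      simp [unitCube]
    rw [hcube, ← volume_pi]
    exact hof.restrict_preimage (MeasurableSet.univ_pi fun _ => measurableSet_Ioo)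
  have h3 : MeasurePreserving (WithLp.toLp 2) _ (gaussianEuclidean n 1) :=
    ⟨(PiLp.volume_preserving_toLp (Fin n)).measurable, map_toLp_pi_gaussianReal n⟩
  exact h3.comp (h1.comp (h2.comp hc))

/-- By Lusin–Souslin, an injective measurable map out of a standard Borel space has a measurable
inverse on its range. -/
theorem measurableEmbedding_cubeToEuclidean (n : ℕ) : MeasurableEmbedding (cubeToEuclidean n) := by
  have := (measurableSet_unitCube n).standardBorel
  refine (measurePreserving_cubeToEuclidean n).measurable.measurableEmbedding fun x y h => ?_
  ext i
  exact injOn_normalQuantile (x.2 i) (y.2 i)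
    (congrArg (fun z : EuclideanSpace ℝ (Fin n) => z i) h)

theorem range_cubeToEuclidean (n : ℕ) : range (cubeToEuclidean n) = univ := by
  refine eq_univ_of_forall fun y => ?_
  choose x hx hy using fun i => exists_normalQuantile_eq (y i)
  exact ⟨⟨WithLp.toLp 2 x, hx⟩, by ext i; exact hy i⟩

theorem gaussianEuclidean_univ (n : ℕ) : gaussianEuclidean n 1 univ = 1 := by
  rw [← map_toLp_pi_gaussianReal, Measure.map_apply
    (PiLp.volume_preserving_toLp (Fin n)).measurable .univ, preimage_univ, measure_univ]

/-! ### Affine charts and the Riemannian volume of projective space -/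

namespace RP

variable {n : ℕ}

@[simp]
theorem homog_apply_same (i : Fin (n + 1)) (u : EuclideanSpace ℝ (Fin n)) : homog i u i = 1 := by
  simp [homog]

@[simp]
theorem homog_apply_succAbove (i : Fin (n + 1)) (u : EuclideanSpace ℝ (Fin n)) (j : Fin n) :
    homog i u (i.succAbove j) = u j := by
  simp [homog]

/-- The linear inclusion of `ℝⁿ` in `ℝⁿ⁺¹` as the hyperplane where the `i`-th coordinate is `0`. -/
noncomputable def inclusion (i : Fin (n + 1)) :
    EuclideanSpace ℝ (Fin n) →L[ℝ] EuclideanSpace ℝ (Fin (n + 1)) :=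
  LinearMap.toContinuousLinearMap
    { toFun := fun u => WithLp.toLp 2 (i.insertNth (α := fun _ => ℝ) 0 fun j => u j)
      map_add' := fun u v => by
        ext j
        refine i.succAboveCases ?_ (fun j => ?_) j <;> simp
      map_smul' := fun c u => by
        ext j
        refine i.succAboveCases ?_ (fun j => ?_) j <;> simp }

@[simp]
theorem inclusion_apply_same (i : Fin (n + 1)) (u : EuclideanSpace ℝ (Fin n)) :
    inclusion i u i = 0 := by
  simp [inclusion]

@[simp]
theorem inclusion_apply_succAbove (i : Fin (n + 1)) (u : EuclideanSpace ℝ (Fin n)) (j : Fin n) :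
    inclusion i u (i.succAbove j) = u j := by
  simp [inclusion]

theorem homog_eq_add_inclusion (i : Fin (n + 1)) :
    homog i = fun u : EuclideanSpace ℝ (Fin n) => EuclideanSpace.single i 1 + inclusion i u := by
  funext u
  ext j
  refine i.succAboveCases ?_ (fun j => ?_) j <;> simp

theorem continuous_homog (i : Fin (n + 1)) :
    Continuous (homog i : EuclideanSpace ℝ (Fin n) → _) := by
  rw [homog_eq_add_inclusion]
  fun_prop

theorem inner_inclusion_inclusion (i : Fin (n + 1)) (u v : EuclideanSpace ℝ (Fin n)) :
    inner ℝ (inclusion i u) (inclusion i v) = inner ℝ u v := by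
  simp only [PiLp.inner_apply, Fin.sum_univ_succAbove _ i]
  simp

theorem inner_homog_inclusion (i : Fin (n + 1)) (u v : EuclideanSpace ℝ (Fin n)) :
    inner ℝ (homog i u) (inclusion i v) = inner ℝ u v := by
  simp only [PiLp.inner_apply, Fin.sum_univ_succAbove _ i]
  simp

theorem inner_homog_homog (i : Fin (n + 1)) (u v : EuclideanSpace ℝ (Fin n)) :
    inner ℝ (homog i u) (homog i v) = 1 + inner ℝ u v := by
  simp only [PiLp.inner_apply, Fin.sum_univ_succAbove _ i]
  simp

theorem norm_homog (i : Fin (n + 1)) (u : EuclideanSpace ℝ (Fin n)) :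
    ‖homog i u‖ = √(1 + ‖u‖ ^ 2) := by
  rw [norm_eq_sqrt_real_inner, inner_homog_homog, real_inner_self_eq_norm_sq]

/-- Differentiating `h / ‖h‖` gives `‖h‖⁻¹` times the component of the increment orthogonal to `h`.
-/
theorem fderiv_sphereLift (i : Fin (n + 1)) (u v : EuclideanSpace ℝ (Fin n)) :
    fderiv ℝ (sphereLift i) u v = (√(1 + ‖u‖ ^ 2))⁻¹ •
      (inclusion i v - ((1 + ‖u‖ ^ 2)⁻¹ * inner ℝ u v) • homog i u) := by
  have hq : 0 < 1 + ‖u‖ ^ 2 := by positivity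
  have h1 : HasFDerivAt (fun u : EuclideanSpace ℝ (Fin n) => 1 + ‖u‖ ^ 2) (2 • innerSL ℝ u) u :=
    ((hasStrictFDerivAt_norm_sq u).hasFDerivAt).const_add 1
  have h2 : HasFDerivAt (fun u : EuclideanSpace ℝ (Fin n) => (√(1 + ‖u‖ ^ 2))⁻¹) _ u :=
    (hasDerivAt_inv (Real.sqrt_pos.2 hq).ne').comp_hasFDerivAt u (h1.sqrt hq.ne')
  have h3 : HasFDerivAt (homog i) (inclusion i) u := by
    rw [homog_eq_add_inclusion]
    exact (inclusion i).hasFDerivAt.const_add _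
  have h4 : sphereLift i = fun u : EuclideanSpace ℝ (Fin n) => (√(1 + ‖u‖ ^ 2))⁻¹ • homog i u := by
    funext u
    rw [sphereLift, norm_homog]
  have h5 := (h2.smul h3).congr_of_eventuallyEq (.of_eq h4)
  rw [h5.fderiv]
  have hs : √(1 + ‖u‖ ^ 2) ^ 2 = 1 + ‖u‖ ^ 2 := Real.sq_sqrt hq.le
  have hs0 : √(1 + ‖u‖ ^ 2) ≠ 0 := by positivity
  simp only [sub_eq_add_neg, ← neg_smul, smul_add, smul_smul, add_apply, smul_apply,
    ContinuousLinearMap.smulRight_apply, innerSL_apply_apply]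
  congr 2
  simp only [smul_eq_mul, nsmul_eq_mul, Nat.cast_ofNat, hs]
  field_simp

theorem metric_eq (i : Fin (n + 1)) (u : EuclideanSpace ℝ (Fin n)) :
    metric i u = (1 + ‖u‖ ^ 2)⁻¹ • (1 - Matrix.replicateCol Unit ((1 + ‖u‖ ^ 2)⁻¹ • u.ofLp) *
      Matrix.replicateRow Unit u.ofLp) := by
  have hq : 0 < 1 + ‖u‖ ^ 2 := by positivity
  have hs : (√(1 + ‖u‖ ^ 2))⁻¹ ^ 2 = (1 + ‖u‖ ^ 2)⁻¹ := by rw [inv_pow, Real.sq_sqrt hq.le]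
  have hh : ‖homog i u‖ ^ 2 = 1 + ‖u‖ ^ 2 := by rw [norm_homog, Real.sq_sqrt hq.le]
  ext j k
  have he : inner ℝ (EuclideanSpace.single j (1 : ℝ)) (EuclideanSpace.single k 1) =
      if j = k then (1 : ℝ) else 0 := by
    simp [EuclideanSpace.inner_single_right, eq_comm]
  have hu : ∀ l, inner ℝ u (EuclideanSpace.single l (1 : ℝ)) = u l := fun l => by
    simp [EuclideanSpace.inner_single_right]
  trans (1 + ‖u‖ ^ 2)⁻¹ * ((if j = k then 1 else 0) - (1 + ‖u‖ ^ 2)⁻¹ * u j * u k)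
  swap
  · simp [Matrix.mul_apply, Matrix.one_apply, mul_assoc]
  simp only [metric, Matrix.of_apply, fderiv_sphereLift, real_inner_smul_left,
    real_inner_smul_right, inner_sub_left, inner_sub_right, inner_inclusion_inclusion,
    inner_homog_inclusion, real_inner_self_eq_norm_sq, hh, he, hu,
    real_inner_comm (homog i u) (inclusion i _)]
  rw [← hs]
  have hq1 : (√(1 + ‖u‖ ^ 2))⁻¹ ^ 2 * (1 + ‖u‖ ^ 2) = 1 := by
    rw [hs, inv_mul_cancel₀ hq.ne']
  -- Only the quadratic term contains `‖homog i u‖²`; cancelling it against one factor `(1 +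
  -- ‖u‖²)⁻¹` merges it with the two cross terms.
  linear_combination (√(1 + ‖u‖ ^ 2))⁻¹ ^ 4 * u j * u k * hq1

/-- The metric is a scalar times a rank-one perturbation of the identity. Exchanging the factors in
`det (1 - A * B)` leaves a `1 × 1` determinant, which supplies the last power of `(1 + ‖u‖²)⁻¹`. -/
theorem det_metric (i : Fin (n + 1)) (u : EuclideanSpace ℝ (Fin n)) :
    (metric i u).det = ((1 + ‖u‖ ^ 2)⁻¹) ^ (n + 1) := by
  have hq : 0 < 1 + ‖u‖ ^ 2 := by positivity
  rw [metric_eq, Matrix.det_smul, Matrix.det_one_sub_mul_comm, Fintype.card_fin, pow_succ]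
  congr 1
  have : u.ofLp ⬝ᵥ u.ofLp = ‖u‖ ^ 2 := by
    rw [EuclideanSpace.real_norm_sq_eq, dotProduct]
    exact Finset.sum_congr rfl fun _ _ => (sq _).symm
  simp [Matrix.det_unique, Matrix.mul_apply, ← dotProduct.eq_1, this]
  field_simp
  ring

theorem rep_mk_eq_zero_iff {v : EuclideanSpace ℝ (Fin (n + 1))} (hv : v ≠ 0) (i : Fin (n + 1)) :
    (Projectivization.mk ℝ v hv).rep i = 0 ↔ v i = 0 := by
  obtain ⟨a, ha⟩ := Projectivization.exists_smul_eq_mk_rep ℝ v hv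
  rw [← ha]
  simp [Units.smul_def]

theorem continuous_ofChart (i : Fin (n + 1)) :
    Continuous (ofChart i : EuclideanSpace ℝ (Fin n) → RP n) := by
  have h : Continuous fun v : {v : EuclideanSpace ℝ (Fin (n + 1)) // v ≠ 0} =>
      Projectivization.mk ℝ v.1 v.2 := continuous_coinduced_rng
  exact h.comp ((continuous_homog i).subtype_mk (homog_ne_zero i))

theorem injective_ofChart (i : Fin (n + 1)) :
    Function.Injective (ofChart i : EuclideanSpace ℝ (Fin n) → RP n) := by
  intro u v h
  obtain ⟨a, ha⟩ := (Projectivization.mk_eq_mk_iff' ℝ _ _ _ _).1 h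
  have h1 : a = 1 := by simpa using congrArg (fun w => w.ofLp i) ha
  ext j
  simpa [h1] using (congrArg (fun w => w.ofLp (i.succAbove j)) ha).symm

theorem exists_ofChart_eq_mk {v : EuclideanSpace ℝ (Fin (n + 1))} (hv : v ≠ 0) (i : Fin (n + 1))
    (h : v i ≠ 0) :
    ofChart i (WithLp.toLp 2 fun j => v (i.succAbove j) / v i) = Projectivization.mk ℝ v hv := by
  refine (Projectivization.mk_eq_mk_iff' ℝ _ _ _ _).2 ⟨(v i)⁻¹, ?_⟩
  ext j
  refine i.succAboveCases ?_ (fun j => ?_) j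
  · simp [h]
  · simp [div_eq_inv_mul]

theorem isOpenEmbedding_ofChart (i : Fin (n + 1)) :
    Topology.IsOpenEmbedding (ofChart i : EuclideanSpace ℝ (Fin n) → RP n) := by
  refine .of_continuous_injective_isOpenMap (continuous_ofChart i) (injective_ofChart i)
    fun U hU => ?_
  let c : {v : EuclideanSpace ℝ (Fin (n + 1)) // v ≠ 0} → EuclideanSpace ℝ (Fin n) :=
    fun v => WithLp.toLp 2 fun j => v.1 (i.succAbove j) / v.1 i
  have hD : IsOpen {v : {v : EuclideanSpace ℝ (Fin (n + 1)) // v ≠ 0} | v.1 i ≠ 0} :=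
    isOpen_ne_fun (by fun_prop) continuous_const
  have hc : ContinuousOn c {v | v.1 i ≠ 0} := by
    refine (PiLp.continuous_toLp 2 _).comp_continuousOn (continuousOn_pi.2 fun j => ?_)
    exact ContinuousOn.div (by fun_prop) (by fun_prop) fun v hv => hv
  rw [isOpen_coinduced]
  -- The cone over the image of `U` is the set where `v i ≠ 0` and the coordinate ratios lie in `U`.
  convert hc.isOpen_inter_preimage hD hU using 1
  ext ⟨v, hv⟩
  constructor
  · rintro ⟨u, hu, huv⟩
    have hvi : v i ≠ 0 := by
      rw [Ne, ← rep_mk_eq_zero_iff hv i]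
      change ofChart i u = Projectivization.mk ℝ v hv at huv
      rw [← huv, ofChart, rep_mk_eq_zero_iff]
      simp
    refine ⟨hvi, ?_⟩
    have : c ⟨v, hv⟩ = u := injective_ofChart i ((exists_ofChart_eq_mk hv i hvi).trans huv.symm)
    rwa [mem_preimage, this]
  · rintro ⟨hvi, hu⟩
    exact ⟨_, hu, exists_ofChart_eq_mk hv i hvi⟩

theorem measurableEmbedding_affine :
    MeasurableEmbedding (affine : EuclideanSpace ℝ (Fin n) → RP n) :=
  (isOpenEmbedding_ofChart _).measurableEmbedding

theorem range_affine : range (affine : EuclideanSpace ℝ (Fin n) → RP n) = (hyperplane n)ᶜ := by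
  ext p
  constructor
  · rintro ⟨u, rfl⟩
    rw [mem_compl_iff, hyperplane, mem_ofPred_eq, affine, ofChart, rep_mk_eq_zero_iff]
    simp
  · intro hp
    exact ⟨_, (exists_ofChart_eq_mk p.rep_nonzero (Fin.last n) hp).trans p.mk_rep⟩

theorem measurableSet_hyperplane : MeasurableSet (hyperplane n) := by
  rw [← compl_compl (hyperplane n), ← range_affine]
  exact measurableEmbedding_affine.measurableSet_range.compl

theorem volume_coord_eq_zero (k : Fin n) :
    volume {u : EuclideanSpace ℝ (Fin n) | u k = 0} = 0 := by
  have h := (PiLp.volume_preserving_ofLp (Fin n)).measure_preimage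
    (s := {x : Fin n → ℝ | x k = 0})
    (measurableSet_eq_fun (by fun_prop) (by fun_prop)).nullMeasurableSet
  exact h.trans (Measure.pi_hyperplane _ k 0)

/-- The last cell is the whole affine chart. Every other cell lies at infinity, which its own chart
sees as a coordinate hyperplane of measure zero. -/
theorem riemannianVolume_eq (n : ℕ) : riemannianVolume n =
    (volume.withDensity fun u : EuclideanSpace ℝ (Fin n) =>
      ENNReal.ofReal ((√(1 + ‖u‖ ^ 2))⁻¹ ^ (n + 1))).map affine := by
  have hdens : ∀ (i : Fin (n + 1)) (u : EuclideanSpace ℝ (Fin n)),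
      √(metric i u).det = (√(1 + ‖u‖ ^ 2))⁻¹ ^ (n + 1) := by
    intro i u
    rw [det_metric, Real.sqrt_eq_iff_eq_sq (by positivity) (by positivity), ← pow_mul,
      mul_comm, pow_mul, inv_pow (√_), Real.sq_sqrt (by positivity)]
  simp only [riemannianVolume, hdens]
  rw [Fin.sum_univ_castSucc, Finset.sum_eq_zero, zero_add]
  · have hcell : cell (Fin.last n) = (hyperplane n)ᶜ := by
      ext p
      simp only [cell, hyperplane, mem_ofPred_eq, mem_compl_iff, and_iff_left_iff_imp]
      exact fun _ j hj => absurd hj (Fin.le_last j).not_gt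
    rw [hcell, Measure.restrict_map (continuous_ofChart _).measurable
      measurableSet_hyperplane.compl, ← range_affine]
    change Measure.map affine (Measure.restrict _ (affine ⁻¹' range affine)) = _
    rw [preimage_range, Measure.restrict_univ]
  · intro i _
    obtain ⟨k, hk⟩ := Fin.exists_succAbove_eq (Fin.castSucc_lt_last i).ne'
    rw [Measure.restrict_eq_zero]
    refine measure_mono_null (t := hyperplane n)
      (fun p hp => hp.2 _ (Fin.castSucc_lt_last i)) ?_
    rw [Measure.map_apply (continuous_ofChart _).measurable measurableSet_hyperplane]
    refine withDensity_absolutelyContinuous _ _ (measure_mono_null ?_ (volume_coord_eq_zero k))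
    intro u hu
    rwa [mem_preimage, hyperplane, mem_ofPred_eq, ofChart, rep_mk_eq_zero_iff, ← hk,
      homog_apply_succAbove] at hu

end RP

/-! ### The incomplete gamma function and integrals of powers of sine -/

theorem intervalIntegrable_incGamma {t : ℝ} (ht : 0 < t) (a b : ℝ) :
    IntervalIntegrable (fun s : ℝ => s ^ (t - 1) * Real.exp (-s)) volume a b :=
  (intervalIntegral.intervalIntegrable_rpow' (by linarith)).mul_continuousOn (by fun_prop)

theorem continuous_incGamma {t : ℝ} (ht : 0 < t) : Continuous (incGamma t) :=
  intervalIntegral.continuous_primitive (intervalIntegrable_incGamma ht) 0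

theorem hasDerivAt_incGamma {t x : ℝ} (ht : 0 < t) (hx : 0 < x) :
    HasDerivAt (incGamma t) (x ^ (t - 1) * Real.exp (-x)) x := by
  refine intervalIntegral.integral_hasDerivAt_right (intervalIntegrable_incGamma ht 0 x) ?_ ?_
  · exact (Measurable.stronglyMeasurable (by fun_prop)).stronglyMeasurableAtFilter
  · exact (Real.continuousAt_rpow_const _ _ (.inl hx.ne')).mul (by fun_prop)

theorem strictMonoOn_incGamma {t : ℝ} (ht : 0 < t) : StrictMonoOn (incGamma t) (Ici 0) := by
  refine strictMonoOn_of_deriv_pos (convex_Ici 0) (continuous_incGamma ht).continuousOn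
    fun x hx => ?_
  rw [interior_Ici, mem_Ioi] at hx
  rw [(hasDerivAt_incGamma ht hx).deriv]
  positivity

theorem incGamma_zero (t : ℝ) : incGamma t 0 = 0 := by simp [incGamma]

theorem tendsto_incGamma_atTop {t : ℝ} (ht : 0 < t) :
    Filter.Tendsto (incGamma t) Filter.atTop (nhds (Real.Gamma t)) := by
  rw [Real.Gamma_eq_integral ht]
  simp_rw [mul_comm (Real.exp _)]
  refine intervalIntegral_tendsto_integral_Ioi 0 ?_ Filter.tendsto_id
  simpa only [mul_comm] using Real.GammaIntegral_convergent ht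

theorem incGamma_lt_Gamma {t x : ℝ} (ht : 0 < t) (hx : 0 ≤ x) : incGamma t x < Real.Gamma t := by
  refine (strictMonoOn_incGamma ht hx (mem_Ici.2 (by linarith)) (lt_add_one x)).trans_le ?_
  refine ge_of_tendsto (tendsto_incGamma_atTop ht) ?_
  filter_upwards [Filter.eventually_ge_atTop (x + 1)] with y hy
  exact (strictMonoOn_incGamma ht).monotoneOn (mem_Ici.2 (by linarith)) (mem_Ici.2 (by linarith)) hy

/-- Wallis' recursion: passing from `m` to `m + 2` multiplies both sides by `(m + 1) / (m + 2)`. -/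
theorem integral_sin_pow_zero_pi_div_two (m : ℕ) :
    ∫ t in (0 : ℝ)..Real.pi / 2, Real.sin t ^ m =
      √Real.pi / (2 * Real.Gamma ((m : ℝ) / 2 + 1)) * Real.Gamma (((m : ℝ) + 1) / 2) := by
  have hpi : √Real.pi * √Real.pi = Real.pi := Real.mul_self_sqrt Real.pi_pos.le
  have hs : √Real.pi ≠ 0 := by positivity
  induction m using Nat.twoStepInduction with
  | zero =>
    have h : Real.Gamma 2⁻¹ = √Real.pi := by rw [← one_div, Real.Gamma_one_half_eq]
    simp [h]
    linarith
  | one =>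
    have h : Real.Gamma (1 / 2 + 1) = 1 / 2 * √Real.pi := by
      rw [Real.Gamma_add_one (by norm_num), Real.Gamma_one_half_eq]
    have h1 : (((1 : ℕ) : ℝ) + 1) / 2 = 1 := by norm_num
    rw [h1, Nat.cast_one, h, Real.Gamma_one]
    simp
    field_simp
  | more m ih _ =>
    have h1 : Real.Gamma (((m + 2 : ℕ) : ℝ) / 2 + 1) =
        ((m : ℝ) / 2 + 1) * Real.Gamma (m / 2 + 1) := by
      rw [← Real.Gamma_add_one (by positivity)]
      push_cast
      ring_nf
    have h2 : Real.Gamma ((((m + 2 : ℕ) : ℝ) + 1) / 2) =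
        (((m : ℝ) + 1) / 2) * Real.Gamma (((m : ℝ) + 1) / 2) := by
      rw [← Real.Gamma_add_one (by positivity)]
      push_cast
      ring_nf
    have h3 : Real.Gamma ((m : ℝ) / 2 + 1) ≠ 0 := (Real.Gamma_pos_of_pos (by positivity)).ne'
    rw [integral_sin_pow, ih, h1, h2]
    simp
    field_simp

theorem hasDerivAt_integral_sin_pow (m : ℕ) (s : ℝ) :
    HasDerivAt (fun s => ∫ t in (0 : ℝ)..s, Real.sin t ^ m) (Real.sin s ^ m) s :=
  ((Real.continuous_sin.pow m).integral_hasStrictDerivAt 0 s).hasDerivAt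

theorem continuous_integral_sin_pow (m : ℕ) :
    Continuous fun s : ℝ => ∫ t in (0 : ℝ)..s, Real.sin t ^ m :=
  continuous_iff_continuousAt.2 fun s => (hasDerivAt_integral_sin_pow m s).continuousAt

theorem strictMonoOn_integral_sin_pow (m : ℕ) :
    StrictMonoOn (fun s : ℝ => ∫ t in (0 : ℝ)..s, Real.sin t ^ m) (Icc 0 (Real.pi / 2)) := by
  refine strictMonoOn_of_deriv_pos (convex_Icc _ _) (continuous_integral_sin_pow m).continuousOn
    fun x hx => ?_
  rw [interior_Icc] at hx
  rw [(hasDerivAt_integral_sin_pow m x).deriv]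
  exact pow_pos (Real.sin_pos_of_pos_of_lt_pi hx.1 (by linarith [hx.2, Real.pi_pos])) m

/-! ### The radius function -/

namespace RP

variable {n : ℕ}

theorem integral_sin_pow_pred (hn : 0 < n) :
    ∫ t in (0 : ℝ)..Real.pi / 2, Real.sin t ^ (n - 1) =
      √Real.pi / (2 * Real.Gamma (((n : ℝ) + 1) / 2)) * Real.Gamma ((n : ℝ) / 2) := by
  rw [integral_sin_pow_zero_pi_div_two, Nat.cast_pred hn]
  ring_nf

theorem radius_coeff_pos (n : ℕ) : 0 < √Real.pi / (2 * Real.Gamma (((n : ℝ) + 1) / 2)) := by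
  have := Real.Gamma_pos_of_pos (show 0 < ((n : ℝ) + 1) / 2 by positivity)
  positivity

theorem IsRadius.eq {r s t : ℝ} (hs : IsRadius n r s) (ht : IsRadius n r t) : s = t :=
  (strictMonoOn_integral_sin_pow (n - 1)).injOn (Ico_subset_Icc_self hs.1)
    (Ico_subset_Icc_self ht.1) (hs.2.trans ht.2.symm)

theorem existsUnique_isRadius (hn : 0 < n) {r : ℝ} : ∃! s, IsRadius n r s := by
  have hn2 : 0 < (n : ℝ) / 2 := by positivity
  have hr2 : 0 ≤ r ^ 2 / 2 := by positivity
  have hk := radius_coeff_pos n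
  have hγ : 0 ≤ incGamma ((n : ℝ) / 2) (r ^ 2 / 2) := by
    rw [← incGamma_zero ((n : ℝ) / 2)]
    exact (strictMonoOn_incGamma hn2).monotoneOn self_mem_Ici hr2 hr2
  -- The strict inequality between `γ` and `Γ` keeps the solution away from `π/2`.
  have hlt := mul_lt_mul_of_pos_left (incGamma_lt_Gamma hn2 hr2) hk
  rw [← integral_sin_pow_pred hn] at hlt
  obtain ⟨s, hs, hs'⟩ := intermediate_value_Icc (show 0 ≤ Real.pi / 2 by positivity)
    (continuous_integral_sin_pow (n - 1)).continuousOn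
    ⟨(intervalIntegral.integral_same.trans_le (mul_nonneg hk.le hγ)), hlt.le⟩
  have h : IsRadius n r s := by
    refine ⟨⟨hs.1, lt_of_le_of_ne hs.2 ?_⟩, hs'⟩
    rintro rfl
    exact hlt.ne' hs'
  exact ⟨s, h, fun t ht => ht.eq h⟩

theorem radius_zero {ρ : ℝ → ℝ} (hρ : ∀ r : ℝ, 0 ≤ r → IsRadius n r (ρ r)) : ρ 0 = 0 :=
  (hρ 0 le_rfl).eq ⟨⟨le_rfl, by positivity⟩, by simp [incGamma_zero]⟩

theorem strictMonoOn_radius (hn : 0 < n) {ρ : ℝ → ℝ} (hρ : ∀ r : ℝ, 0 ≤ r → IsRadius n r (ρ r)) :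
    StrictMonoOn ρ (Ici 0) := by
  intro r hr s hs hrs
  have hr0 : 0 ≤ r := hr
  rw [← (strictMonoOn_integral_sin_pow (n - 1)).lt_iff_lt (Ico_subset_Icc_self (hρ r hr).1)
    (Ico_subset_Icc_self (hρ s hs).1)]
  simp only [(hρ r hr).2, (hρ s hs).2]
  refine mul_lt_mul_of_pos_left (strictMonoOn_incGamma (by positivity) ?_ ?_ ?_)
    (radius_coeff_pos n)
  · exact mem_Ici.2 (by positivity)
  · exact mem_Ici.2 (by positivity)
  · nlinarith

/-- Continuity of `ρ` is not needed: the intermediate value theorem is applied to the right side of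
the equation as a function of `r`, and uniqueness of the solution identifies `ρ r` with `s`. -/
theorem exists_radius_eq (hn : 0 < n) {ρ : ℝ → ℝ} (hρ : ∀ r : ℝ, 0 ≤ r → IsRadius n r (ρ r))
    {s : ℝ} (hs : s ∈ Ico 0 (Real.pi / 2)) :
    ∃ r, 0 ≤ r ∧ ρ r = s := by
  have hn2 : 0 < (n : ℝ) / 2 := by positivity
  have hcont : Continuous fun r : ℝ => √Real.pi / (2 * Real.Gamma (((n : ℝ) + 1) / 2)) *
      incGamma ((n : ℝ) / 2) (r ^ 2 / 2) :=
    continuous_const.mul ((continuous_incGamma hn2).comp (by fun_prop))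
  have hmono := strictMonoOn_integral_sin_pow (n - 1)
  have hlt := hmono (Ico_subset_Icc_self hs) (right_mem_Icc.2 (by positivity)) hs.2
  have hge := hmono.monotoneOn (left_mem_Icc.2 (by positivity)) (Ico_subset_Icc_self hs) hs.1
  simp only [integral_sin_pow_pred hn, intervalIntegral.integral_same] at hlt hge
  have hq : Filter.Tendsto (fun r : ℝ => r ^ 2 / 2) Filter.atTop Filter.atTop :=
    (Filter.tendsto_pow_atTop two_ne_zero).atTop_div_const two_pos
  have htend := ((tendsto_incGamma_atTop hn2).comp hq).const_mul
    (√Real.pi / (2 * Real.Gamma (((n : ℝ) + 1) / 2)))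
  obtain ⟨R, hR, hR0⟩ := ((htend.eventually (eventually_gt_nhds hlt)).and
    (Filter.eventually_ge_atTop 0)).exists
  obtain ⟨r, hr, hrs⟩ := intermediate_value_Icc hR0 hcont.continuousOn
    ⟨by simpa [incGamma_zero] using hge, hR.le⟩
  exact ⟨r, hr.1, (hρ r hr.1).eq ⟨hs, hrs.symm⟩⟩

/-! ### Radial maps as bijections -/

theorem radialMap_congr {f g : ℝ → ℝ} (h : ∀ r, 0 ≤ r → f r = g r) :
    radialMap (n := n) f = radialMap g := by
  funext x
  rw [radialMap, radialMap, h _ (norm_nonneg x)]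

theorem norm_radialMap {f : ℝ → ℝ} (h0 : f 0 = 0) (hf : StrictMonoOn f (Ici 0))
    (x : EuclideanSpace ℝ (Fin n)) : ‖radialMap f x‖ = f ‖x‖ := by
  rcases eq_or_ne x 0 with rfl | hx
  · simp [radialMap, h0]
  · have hf0 : 0 ≤ f ‖x‖ := h0 ▸ hf.monotoneOn self_mem_Ici (norm_nonneg x) (norm_nonneg x)
    rw [radialMap, norm_smul, Real.norm_of_nonneg (by positivity),
      div_mul_cancel₀ _ (norm_ne_zero_iff.2 hx)]

theorem injective_radialMap {f : ℝ → ℝ} (h0 : f 0 = 0) (hf : StrictMonoOn f (Ici 0)) :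
    Function.Injective (radialMap (n := n) f) := by
  intro x y h
  have hn : ‖x‖ = ‖y‖ := hf.injOn (norm_nonneg x) (norm_nonneg y) (by
    rw [← norm_radialMap h0 hf, ← norm_radialMap h0 hf, h])
  rcases eq_or_ne y 0 with rfl | hy
  · simpa using hn
  · have hy' : 0 < ‖y‖ := norm_pos_iff.2 hy
    have hfy : 0 < f ‖y‖ := h0 ▸ hf self_mem_Ici hy'.le hy'
    rw [radialMap, radialMap, hn] at h
    exact smul_right_injective _ (by positivity : f ‖y‖ / ‖y‖ ≠ 0) h

theorem range_radialMap {f : ℝ → ℝ} (h0 : f 0 = 0) (hf : StrictMonoOn f (Ici 0)) :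
    range (radialMap (n := n) f) = {y | ‖y‖ ∈ f '' Ici 0} := by
  ext y
  constructor
  · rintro ⟨x, rfl⟩
    exact ⟨‖x‖, norm_nonneg x, (norm_radialMap h0 hf x).symm⟩
  · rintro ⟨r, hr, hry⟩
    have hr0 : 0 ≤ r := hr
    rcases eq_or_ne y 0 with rfl | hy
    · exact ⟨0, by simp [radialMap]⟩
    · have hy' : ‖y‖ ≠ 0 := norm_ne_zero_iff.2 hy
      have hr' : r ≠ 0 := by
        rintro rfl
        exact hy' (hry.symm.trans h0)
      have hx : ‖(r / ‖y‖) • y‖ = r := by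
        rw [norm_smul, Real.norm_of_nonneg (by positivity), div_mul_cancel₀ _ hy']
      refine ⟨(r / ‖y‖) • y, ?_⟩
      rw [radialMap, hx, hry, smul_smul, div_mul_div_cancel₀ hr', div_self hy', one_smul]

end RP

/-! ### Transport of the Gaussian to the ball and to projective space -/

namespace RP

variable {n : ℕ}

theorem volume_const_pos (n : ℕ) :
    0 < Real.Gamma (((n : ℝ) + 1) / 2) / Real.pi ^ (((n : ℝ) + 1) / 2) := by
  have := Real.Gamma_pos_of_pos (show 0 < ((n : ℝ) + 1) / 2 by positivity)
  positivity

/-- A primitive of the radial density of the standard Gaussian measure. -/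
theorem hasDerivAt_gaussian_primitive (hn : 0 < n) {r : ℝ} (hr : 0 < r) :
    HasDerivAt (fun r => Real.Gamma (((n : ℝ) + 1) / 2) / Real.pi ^ (((n : ℝ) + 1) / 2) *
      (√Real.pi / (2 * Real.Gamma (((n : ℝ) + 1) / 2)) * incGamma ((n : ℝ) / 2) (r ^ 2 / 2)))
      (r ^ (n - 1) * (1 / (2 * Real.pi * 1) ^ ((n : ℝ) / 2) * Real.exp (-r ^ 2 / (2 * 1)))) r := by
  have hG := (Real.Gamma_pos_of_pos (show 0 < ((n : ℝ) + 1) / 2 by positivity)).ne'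
  have h := (((hasDerivAt_incGamma (t := (n : ℝ) / 2) (by positivity)
    (show 0 < r ^ 2 / 2 by positivity)).comp r (((hasDerivAt_id r).pow 2).div_const 2)).const_mul
    (√Real.pi / (2 * Real.Gamma (((n : ℝ) + 1) / 2)))).const_mul
    (Real.Gamma (((n : ℝ) + 1) / 2) / Real.pi ^ (((n : ℝ) + 1) / 2))
  convert! h using 1
  -- The factor `r` from the chain rule turns `r^(n-2)` into the polar weight `r^(n-1)`.
  have h1 : (r ^ 2 / 2) ^ ((n : ℝ) / 2 - 1) * r = r ^ (n - 1) * (2 / 2 ^ ((n : ℝ) / 2)) := by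
    rw [Real.div_rpow (by positivity) (by positivity), ← Real.rpow_natCast r 2,
      ← Real.rpow_mul hr.le, ← Real.rpow_natCast r (n - 1), Nat.cast_pred hn,
      Real.rpow_sub_one (by norm_num : (2 : ℝ) ≠ 0),
      show ((2 : ℕ) : ℝ) * ((n : ℝ) / 2 - 1) = (n : ℝ) - 1 - 1 by push_cast; ring,
      Real.rpow_sub_one hr.ne' ((n : ℝ) - 1)]
    field_simp
  have h2 : Real.pi ^ (((n : ℝ) + 1) / 2) = Real.pi ^ ((n : ℝ) / 2) * √Real.pi := by
    rw [Real.sqrt_eq_rpow, ← Real.rpow_add Real.pi_pos]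
    ring_nf
  have h3 : (2 * Real.pi * 1) ^ ((n : ℝ) / 2) = 2 ^ ((n : ℝ) / 2) * Real.pi ^ ((n : ℝ) / 2) := by
    rw [mul_one, Real.mul_rpow (by norm_num) Real.pi_pos.le]
  have h4 : -(r ^ 2 / 2) = -r ^ 2 / (2 * 1) := by ring
  rw [h2, h3]
  simp only [id, h4, Nat.cast_ofNat, Nat.add_one_sub_one, pow_one, mul_one]
  rw [show 2 * r / 2 = r by ring, mul_right_comm ((r ^ 2 / 2) ^ _), h1]
  field_simp

/-- Common form of the two transports below: the target is the weighted ball for the profile `ρ`,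
and the affine chart for `tan ∘ ρ`. -/
theorem map_radialMap_gaussian (hn : 0 < n) {f G v : ℝ → ℝ} {V : ℝ → ℝ≥0∞} {T : Set ℝ}
    (hT : MeasurableSet T) (hf : Measurable f) (hV : Measurable V)
    (hfT : f '' Ioi 0 = T) (hv : ∀ s ∈ T, 0 ≤ v s)
    (hG : ∀ s ∈ T, HasDerivAt G (v s) s) (hGi : InjOn G T)
    (hGf : ∀ r, 0 < r → G (f r) = Real.Gamma (((n : ℝ) + 1) / 2) / Real.pi ^ (((n : ℝ) + 1) / 2) *
      (√Real.pi / (2 * Real.Gamma (((n : ℝ) + 1) / 2)) * incGamma ((n : ℝ) / 2) (r ^ 2 / 2)))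
    (hvV : (volume.restrict (Ioi 0)).withDensity (fun r => ENNReal.ofReal (r ^ (n - 1)) * V r) =
      (volume.restrict T).withDensity fun s => ENNReal.ofReal (v s)) :
    (gaussianEuclidean n 1).map (radialMap f) = volume.withDensity fun x => V ‖x‖ := by
  have hc := volume_const_pos n
  have hk := radius_coeff_pos n
  refine map_radialMap_withDensity hn hf (w := fun r => ENNReal.ofReal
    (1 / (2 * Real.pi * 1) ^ ((n : ℝ) / 2) * Real.exp (-r ^ 2 / (2 * 1)))) (by fun_prop) hV ?_
  rw [hvV, ← map_withDensity_of_primitive measurableSet_Ioi hT hf hfT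
    (fun r hr => hasDerivAt_gaussian_primitive hn hr) hG
    (fun r (hr : 0 < r) => by positivity) hv ?_ hGi hGf]
  · congr 1
    refine withDensity_congr_ae (ae_restrict_of_forall_mem measurableSet_Ioi fun r hr => ?_)
    have hr' : 0 < r := hr
    simp only [ENNReal.ofReal_mul (pow_nonneg hr'.le (n - 1))]
  · intro r hr s hs h
    have hr' : 0 < r := hr
    have hs' : 0 < s := hs
    have h' := (strictMonoOn_incGamma (t := (n : ℝ) / 2) (by positivity)).injOn
      (mem_Ici.2 (by positivity)) (mem_Ici.2 (by positivity))
      (mul_left_cancel₀ hk.ne' (mul_left_cancel₀ hc.ne' h))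
    exact (pow_left_inj₀ hr'.le hs'.le two_ne_zero).1 (by linarith)

/-- Since `ρ` is arbitrary on negative numbers, it is clamped there to get a monotone, hence
measurable, function; radial maps do not see the change. -/
theorem monotone_radius_max (hn : 0 < n) {ρ : ℝ → ℝ}
    (hρ : ∀ r : ℝ, 0 ≤ r → IsRadius n r (ρ r)) : Monotone fun r => ρ (max r 0) := fun r s h =>
  (strictMonoOn_radius hn hρ).monotoneOn (le_max_right r 0) (le_max_right s 0)
    (max_le_max_right 0 h)

theorem image_radius_max (hn : 0 < n) {ρ : ℝ → ℝ}
    (hρ : ∀ r : ℝ, 0 ≤ r → IsRadius n r (ρ r)) :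
    (fun r => ρ (max r 0)) '' Ioi 0 = Ioo 0 (Real.pi / 2) := by
  ext s
  constructor
  · rintro ⟨r, hr, rfl⟩
    have hr' : 0 < r := hr
    simp only [max_eq_left hr'.le]
    exact ⟨radius_zero hρ ▸ strictMonoOn_radius hn hρ self_mem_Ici hr'.le hr', (hρ r hr'.le).1.2⟩
  · intro hs
    obtain ⟨r, hr, rfl⟩ := exists_radius_eq hn hρ (Ioo_subset_Ico_self hs)
    have hr0 : r ≠ 0 := by
      rintro rfl
      exact hs.1.ne' (radius_zero hρ)
    exact ⟨r, hr.lt_of_ne' hr0, by simp only [max_eq_left hr]⟩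

theorem map_radialMap_radius (hn : 0 < n) {ρ : ℝ → ℝ}
    (hρ : ∀ r : ℝ, 0 ≤ r → IsRadius n r (ρ r)) :
    (gaussianEuclidean n 1).map (radialMap ρ) =
      radialMeasure n (Real.pi / 2) (weight n) := by
  have hc := volume_const_pos n
  have hwm : Measurable (weight n) := by
    unfold weight
    fun_prop
  -- The restriction to the ball is absorbed into a radial density on all of `ℝⁿ`.
  have hball : radialMeasure n (Real.pi / 2) (weight n) =
      volume.withDensity fun x : EuclideanSpace ℝ (Fin n) =>
        (Iio (Real.pi / 2)).indicator (fun r => ENNReal.ofReal (weight n r)) ‖x‖ := by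
    rw [radialMeasure, ← withDensity_indicator Metric.isOpen_ball.measurableSet]
    congr 1
    funext x
    simp [indicator]
  rw [radialMap_congr (g := fun r => ρ (max r 0)) fun r hr => by rw [max_eq_left hr], hball]
  refine map_radialMap_gaussian hn measurableSet_Ioo (monotone_radius_max hn hρ).measurable
    (hwm.ennreal_ofReal.indicator measurableSet_Iio) (image_radius_max hn hρ)
    (G := fun s => Real.Gamma (((n : ℝ) + 1) / 2) / Real.pi ^ (((n : ℝ) + 1) / 2) *
      ∫ t in (0 : ℝ)..s, Real.sin t ^ (n - 1))
    (v := fun s => Real.Gamma (((n : ℝ) + 1) / 2) / Real.pi ^ (((n : ℝ) + 1) / 2) *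
      Real.sin s ^ (n - 1)) (fun s hs => ?_)
    (fun s _ => (hasDerivAt_integral_sin_pow _ s).const_mul _) (fun s hs t ht h => ?_)
    (fun r hr => ?_) ?_
  · have := Real.sin_pos_of_pos_of_lt_pi hs.1 (by linarith [hs.2, Real.pi_pos])
    positivity
  · exact (strictMonoOn_integral_sin_pow (n - 1)).injOn (Ioo_subset_Icc_self hs)
      (Ioo_subset_Icc_self ht) (mul_left_cancel₀ hc.ne' h)
  · simp only [max_eq_left hr.le, (hρ r hr.le).2]
  · have h1 : (fun r : ℝ => ENNReal.ofReal (r ^ (n - 1)) *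
        (Iio (Real.pi / 2)).indicator (fun r => ENNReal.ofReal (weight n r)) r) =
        (Iio (Real.pi / 2)).indicator fun r =>
          ENNReal.ofReal (r ^ (n - 1)) * ENNReal.ofReal (weight n r) := by
      funext r
      by_cases h : r ∈ Iio (Real.pi / 2) <;> simp [h]
    rw [h1, withDensity_indicator measurableSet_Iio, Measure.restrict_restrict measurableSet_Iio,
      inter_comm, Ioi_inter_Iio]
    refine withDensity_congr_ae (ae_restrict_of_forall_mem measurableSet_Ioo fun r hr => ?_)
    have hr0 : r ^ (n - 1) ≠ 0 := pow_ne_zero _ hr.1.ne'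
    simp only [← ENNReal.ofReal_mul (pow_nonneg hr.1.le (n - 1)), weight]
    congr 1
    field_simp

theorem map_radialMap_tan_radius (hn : 0 < n) {ρ : ℝ → ℝ}
    (hρ : ∀ r : ℝ, 0 ≤ r → IsRadius n r (ρ r)) :
    (gaussianEuclidean n 1).map (radialMap fun r => Real.tan (ρ r)) =
      volume.withDensity fun x => ENNReal.ofReal
        (Real.Gamma (((n : ℝ) + 1) / 2) / Real.pi ^ (((n : ℝ) + 1) / 2) *
          (√(1 + ‖x‖ ^ 2))⁻¹ ^ (n + 1)) := by
  have hc := volume_const_pos n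
  have harc : ∀ t : ℝ, 0 < t → Real.arctan t ∈ Ioo 0 (Real.pi / 2) := fun t ht =>
    ⟨Real.arctan_pos.2 ht, Real.arctan_lt_pi_div_two t⟩
  have htan : Measurable Real.tan := by
    rw [show Real.tan = fun x => Real.sin x / Real.cos x from funext Real.tan_eq_sin_div_cos]
    fun_prop
  have himage : (fun r => Real.tan (ρ (max r 0))) '' Ioi 0 = Ioi 0 := by
    rw [← image_image Real.tan, image_radius_max hn hρ]
    ext t
    constructor
    · rintro ⟨s, hs, rfl⟩
      exact Real.tan_pos_of_pos_of_lt_pi_div_two hs.1 hs.2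
    · exact fun ht => ⟨Real.arctan t, harc t ht, Real.tan_arctan t⟩
  rw [radialMap_congr (g := fun r => Real.tan (ρ (max r 0))) fun r hr => by rw [max_eq_left hr]]
  refine map_radialMap_gaussian hn measurableSet_Ioi
    (htan.comp (monotone_radius_max hn hρ).measurable)
    (V := fun t => ENNReal.ofReal (Real.Gamma (((n : ℝ) + 1) / 2) /
      Real.pi ^ (((n : ℝ) + 1) / 2) * (√(1 + t ^ 2))⁻¹ ^ (n + 1))) (by fun_prop) himage
    (G := fun t => Real.Gamma (((n : ℝ) + 1) / 2) / Real.pi ^ (((n : ℝ) + 1) / 2) *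
      ∫ s in (0 : ℝ)..Real.arctan t, Real.sin s ^ (n - 1))
    (v := fun t => t ^ (n - 1) * (Real.Gamma (((n : ℝ) + 1) / 2) /
      Real.pi ^ (((n : ℝ) + 1) / 2) * (√(1 + t ^ 2))⁻¹ ^ (n + 1))) (fun t (ht : 0 < t) => ?_)
    (fun t _ => ?_) (fun s hs t ht h => ?_) (fun r hr => ?_) ?_
  · positivity
  · have h := ((hasDerivAt_integral_sin_pow (n - 1) (Real.arctan t)).comp t
      (Real.hasDerivAt_arctan t)).const_mul
      (Real.Gamma (((n : ℝ) + 1) / 2) / Real.pi ^ (((n : ℝ) + 1) / 2))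
    convert! h using 1
    have hs : √(1 + t ^ 2) ^ 2 = 1 + t ^ 2 := Real.sq_sqrt (by positivity)
    -- Of the `n + 1` factors `(√(1 + t²))⁻¹`, `n - 1` come from `sin (arctan t) = t / √(1 + t²)`
    -- and two from the derivative of `arctan`.
    rw [Real.sin_arctan, ← hs, Real.sqrt_sq (Real.sqrt_nonneg _),
      show n + 1 = (n - 1) + 2 by omega, div_pow, pow_add, inv_pow, inv_pow]
    field_simp
  · exact Real.arctan_injective ((strictMonoOn_integral_sin_pow (n - 1)).injOn
      (Ioo_subset_Icc_self (harc s hs)) (Ioo_subset_Icc_self (harc t ht))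
      (mul_left_cancel₀ hc.ne' h))
  · have hm := (hρ r hr.le).1
    simp only [max_eq_left hr.le]
    rw [Real.arctan_tan (by linarith [hm.1, Real.pi_pos]) hm.2, (hρ r hr.le).2]
  · refine withDensity_congr_ae (ae_restrict_of_forall_mem measurableSet_Ioi fun t ht => ?_)
    have ht' : 0 < t := ht
    simp only [ENNReal.ofReal_mul (pow_nonneg ht'.le (n - 1))]

/-- The image of `x` has norm `ρ ‖x‖`, so the factor `ρ ‖x‖` cancels against the denominator in
`exp`. -/
theorem exp_radialMap (hn : 0 < n) {ρ : ℝ → ℝ} (hρ : ∀ r : ℝ, 0 ≤ r → IsRadius n r (ρ r))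
    (x : EuclideanSpace ℝ (Fin n)) :
    exp (radialMap ρ x) = affine (radialMap (fun r => Real.tan (ρ r)) x) := by
  have hmono := strictMonoOn_radius hn hρ
  have h0 := radius_zero hρ
  rw [exp, norm_radialMap h0 hmono]
  rcases eq_or_ne x 0 with rfl | hx
  · simp [radialMap]
  · have hx' : 0 < ‖x‖ := norm_pos_iff.2 hx
    have hρx : 0 < ρ ‖x‖ := h0 ▸ hmono self_mem_Ici hx'.le hx'
    rw [radialMap, radialMap, smul_smul, div_mul_div_cancel₀ hρx.ne']

theorem cubeMap_eq (hn : 0 < n) {ρ : ℝ → ℝ} (hρ : ∀ r : ℝ, 0 ≤ r → IsRadius n r (ρ r)) :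
    cubeMap n ρ = affine ∘ radialMap (fun r => Real.tan (ρ r)) ∘ cubeToEuclidean n :=
  funext fun _ => exp_radialMap hn hρ _

theorem strictMonoOn_tan_radius (hn : 0 < n) {ρ : ℝ → ℝ}
    (hρ : ∀ r : ℝ, 0 ≤ r → IsRadius n r (ρ r)) :
    StrictMonoOn (fun r => Real.tan (ρ r)) (Ici 0) := fun r hr s hs h =>
  Real.tan_lt_tan_of_nonneg_of_lt_pi_div_two (hρ r hr).1.1 (hρ s hs).1.2
    (strictMonoOn_radius hn hρ hr hs h)

theorem measurable_radialMap_of_monotoneOn {f : ℝ → ℝ} (hf : MonotoneOn f (Ici 0)) :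
    Measurable (radialMap (n := n) f) := by
  rw [radialMap_congr (g := fun r => f (max r 0)) fun r hr => by rw [max_eq_left hr]]
  exact measurable_radialMap (Monotone.measurable fun r s h =>
    hf (le_max_right r 0) (le_max_right s 0) (max_le_max_right 0 h))

theorem measurableEmbedding_radialMap {f : ℝ → ℝ} (h0 : f 0 = 0) (hf : StrictMonoOn f (Ici 0)) :
    MeasurableEmbedding (radialMap (n := n) f) :=
  (measurable_radialMap_of_monotoneOn hf.monotoneOn).measurableEmbedding (injective_radialMap h0 hf)

theorem range_radialMap_radius (hn : 0 < n) {ρ : ℝ → ℝ}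
    (hρ : ∀ r : ℝ, 0 ≤ r → IsRadius n r (ρ r)) :
    range (radialMap (n := n) ρ) = Metric.ball 0 (Real.pi / 2) := by
  rw [range_radialMap (radius_zero hρ) (strictMonoOn_radius hn hρ)]
  ext y
  rw [mem_ball_zero_iff]
  constructor
  · rintro ⟨r, hr, hry⟩
    exact hry ▸ (hρ r hr).1.2
  · exact fun hy => exists_radius_eq hn hρ ⟨norm_nonneg y, hy⟩

theorem range_radialMap_tan_radius (hn : 0 < n) {ρ : ℝ → ℝ}
    (hρ : ∀ r : ℝ, 0 ≤ r → IsRadius n r (ρ r)) :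
    range (radialMap (n := n) fun r => Real.tan (ρ r)) = univ := by
  rw [range_radialMap (by simp [radius_zero hρ]) (strictMonoOn_tan_radius hn hρ)]
  refine eq_univ_of_forall fun y => ?_
  obtain ⟨r, hr, h⟩ := exists_radius_eq hn hρ
    ⟨Real.arctan_nonneg.2 (norm_nonneg y), Real.arctan_lt_pi_div_two _⟩
  exact ⟨r, hr, by simp only [h, Real.tan_arctan]⟩

theorem measurableEmbedding_cubeMap (hn : 0 < n) {ρ : ℝ → ℝ}
    (hρ : ∀ r : ℝ, 0 ≤ r → IsRadius n r (ρ r)) : MeasurableEmbedding (cubeMap n ρ) := by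
  rw [cubeMap_eq hn hρ]
  exact measurableEmbedding_affine.comp ((measurableEmbedding_radialMap (by simp [radius_zero hρ])
    (strictMonoOn_tan_radius hn hρ)).comp (measurableEmbedding_cubeToEuclidean n))

theorem range_cubeMap (hn : 0 < n) {ρ : ℝ → ℝ} (hρ : ∀ r : ℝ, 0 ≤ r → IsRadius n r (ρ r)) :
    range (cubeMap n ρ) = (hyperplane n)ᶜ := by
  rw [cubeMap_eq hn hρ, range_comp, range_comp, range_cubeToEuclidean, image_univ,
    range_radialMap_tan_radius hn hρ, image_univ, range_affine]

theorem map_cubeMap (hn : 0 < n) {ρ : ℝ → ℝ} (hρ : ∀ r : ℝ, 0 ≤ r → IsRadius n r (ρ r)) :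
    (cubeUnif n).map (cubeMap n ρ) =
      ENNReal.ofReal (Real.Gamma (((n : ℝ) + 1) / 2) / Real.pi ^ (((n : ℝ) + 1) / 2)) •
        riemannianVolume n := by
  have hm := measurable_radialMap_of_monotoneOn (n := n) (strictMonoOn_tan_radius hn hρ).monotoneOn
  have hq := measurePreserving_cubeToEuclidean n
  rw [cubeMap_eq hn hρ, ← Measure.map_map measurableEmbedding_affine.measurable
    (hm.comp hq.measurable), ← Measure.map_map hm hq.measurable, hq.map_eq,
    map_radialMap_tan_radius hn hρ, riemannianVolume_eq, ← Measure.map_smul,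
    ← withDensity_smul _ (by fun_prop)]
  congr 2
  funext x
  exact ENNReal.ofReal_mul (volume_const_pos n).le

/-- Comparison of total masses: the cube carries mass 1, because its image measure, the Gaussian,
does. -/
theorem ofReal_mul_riemannianVolume_univ (hn : 0 < n) :
    ENNReal.ofReal (Real.Gamma (((n : ℝ) + 1) / 2) / Real.pi ^ (((n : ℝ) + 1) / 2)) *
      riemannianVolume n univ = 1 := by
  choose ρ hρ _ using fun r : ℝ => existsUnique_isRadius (r := r) hn
  have h := congrArg (fun μ => μ univ) (map_cubeMap hn fun r _ => hρ r)
  rw [Measure.map_apply (measurableEmbedding_cubeMap hn fun r _ => hρ r).measurable .univ,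
    preimage_univ, ← gaussianEuclidean_univ n, ← (measurePreserving_cubeToEuclidean n).map_eq,
    Measure.map_apply (measurePreserving_cubeToEuclidean n).measurable .univ] at *
  exact h.symm

theorem riemannianVolume_univ (hn : 0 < n) : riemannianVolume n univ =
    ENNReal.ofReal (Real.pi ^ (((n : ℝ) + 1) / 2) / Real.Gamma (((n : ℝ) + 1) / 2)) := by
  rw [ENNReal.eq_inv_of_mul_eq_one_left ((mul_comm _ _).trans
      (ofReal_mul_riemannianVolume_univ hn)),
    ← ENNReal.ofReal_inv_of_pos (volume_const_pos n), inv_div]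

theorem unif_eq (hn : 0 < n) : unif n =
    ENNReal.ofReal (Real.Gamma (((n : ℝ) + 1) / 2) / Real.pi ^ (((n : ℝ) + 1) / 2)) •
      riemannianVolume n := by
  rw [unif, ← ENNReal.eq_inv_of_mul_eq_one_left (ofReal_mul_riemannianVolume_univ hn)]

theorem measurePreserving_cubeMap (hn : 0 < n) {ρ : ℝ → ℝ}
    (hρ : ∀ r : ℝ, 0 ≤ r → IsRadius n r (ρ r)) :
    MeasurePreserving (cubeMap n ρ) (cubeUnif n) (unif n) :=
  ⟨(measurableEmbedding_cubeMap hn hρ).measurable, (map_cubeMap hn hρ).trans (unif_eq hn).symm⟩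

theorem unif_hyperplane (n : ℕ) : unif n (hyperplane n) = 0 := by
  have h : (affine : EuclideanSpace ℝ (Fin n) → RP n) ⁻¹' hyperplane n = ∅ := by
    rw [preimage_eq_empty_iff, range_affine]
    exact disjoint_compl_right
  rw [unif, Measure.smul_apply, riemannianVolume_eq,
    Measure.map_apply measurableEmbedding_affine.measurable measurableSet_hyperplane, h,
    measure_empty, smul_zero]

/-! ### Explicit formulas in dimensions one and two -/

theorem incGamma_one_half_sq {x : ℝ} (hx : 0 ≤ x) :
    incGamma (1 / 2) (x ^ 2) = √Real.pi * erf x := by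
  -- The integrand of `γ(1/2, ·)` is singular at `0`, so this form of the fundamental theorem asks
  -- for derivatives only in the interior and for continuity at the ends.
  have h := intervalIntegral.integral_eq_sub_of_hasDerivAt_of_le hx
    (f := fun x => incGamma (1 / 2) (x ^ 2)) (f' := fun x => 2 * Real.exp (-x ^ 2))
    ((continuous_incGamma (by norm_num)).comp (by fun_prop)).continuousOn (fun y hy => ?_)
    (Continuous.intervalIntegrable (by fun_prop) _ _)
  · have hs : √Real.pi ≠ 0 := by positivity
    simp only [intervalIntegral.integral_const_mul, ne_eq, OfNat.ofNat_ne_zero, not_false_eq_true,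
      zero_pow, incGamma_zero, sub_zero] at h
    rw [← h, erf]
    field_simp
  · have hy0 : 0 < y := hy.1
    have h2 : HasDerivAt (fun y : ℝ => y ^ 2) (2 * y) y := by simpa using hasDerivAt_pow 2 y
    have h1 := hasDerivAt_incGamma (t := 1 / 2) (by norm_num) (show 0 < y ^ 2 by positivity)
    convert! HasDerivAt.comp (h := fun y => y ^ 2) y h1 h2 using 1
    rw [show (1 / 2 - 1 : ℝ) = -(1 / 2) by norm_num, Real.rpow_neg (by positivity),
      ← Real.sqrt_eq_rpow, Real.sqrt_sq hy0.le]
    field_simp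

theorem incGamma_one (x : ℝ) : incGamma 1 x = 1 - Real.exp (-x) := by
  have h := intervalIntegral.integral_comp_neg (a := 0) (b := x) Real.exp
  simp only [incGamma, sub_self, Real.rpow_zero, one_mul]
  rw [h]
  simp

theorem radius_one {ρ : ℝ → ℝ} (hρ : ∀ r : ℝ, 0 ≤ r → IsRadius 1 r (ρ r)) {r : ℝ} (hr : 0 ≤ r) :
    ρ r = √Real.pi / 2 * incGamma (1 / 2) (r ^ 2 / 2) ∧ ρ r = Real.pi / 2 * erf (r / √2) := by
  have h : ρ r = √Real.pi / 2 * incGamma (1 / 2) (r ^ 2 / 2) := by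
    simpa [show ((1 : ℝ) + 1) / 2 = 1 by norm_num] using (hρ r hr).2
  refine ⟨h, ?_⟩
  have h2 : r ^ 2 / 2 = (r / √2) ^ 2 := by rw [div_pow, Real.sq_sqrt (by norm_num)]
  rw [h, h2, incGamma_one_half_sq (by positivity)]
  linear_combination erf (r / √2) / 2 * Real.mul_self_sqrt Real.pi_pos.le

theorem cubeMap_one {ρ : ℝ → ℝ} (hρ : ∀ r : ℝ, 0 ≤ r → IsRadius 1 r (ρ r)) (x : unitCube 1) :
    cubeMap 1 ρ x = affine !₂[-Real.cot (Real.pi * x.1 0)] := by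
  rw [cubeMap_eq one_pos hρ]
  simp only [Function.comp_apply]
  congr 1
  set y := normalQuantile (x.1 0) with hy
  have hx : erf (y / √2) = 2 * x.1 0 - 1 := erf_normalQuantile (x.2 0)
  have hnorm : ‖cubeToEuclidean 1 x‖ = |y| := by
    rw [EuclideanSpace.norm_eq]
    simp [cubeToEuclidean_apply, Real.sqrt_sq_eq_abs, hy]
  have hcot : -Real.cot (Real.pi * x.1 0) = Real.tan (Real.pi / 2 * erf (y / √2)) := by
    rw [hx, show Real.pi / 2 * (2 * x.1 0 - 1) = -(Real.pi / 2 - Real.pi * x.1 0) by ring,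
      Real.tan_neg, Real.tan_pi_div_two_sub, Real.tan_inv_eq_cot]
  -- Oddness of `tan` and `erf` absorbs the sign `y / |y|`; at `y = 0` both sides vanish.
  have hodd : Real.tan (Real.pi / 2 * erf (|y| / √2)) / |y| * y =
      Real.tan (Real.pi / 2 * erf (y / √2)) := by
    rcases lt_trichotomy y 0 with h | h | h
    · rw [abs_of_neg h, neg_div, erf_neg, mul_neg, Real.tan_neg, neg_div_neg_eq,
        div_mul_cancel₀ _ h.ne]
    · simp [h, erf]
    · rw [abs_of_pos h, div_mul_cancel₀ _ h.ne']
  ext i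
  rw [Subsingleton.elim i 0]
  simp only [radialMap, hnorm, PiLp.smul_apply, cubeToEuclidean_apply, ← hy, smul_eq_mul,
    (radius_one hρ (abs_nonneg y)).2, hodd, hcot]
  simp

theorem radius_two {ρ : ℝ → ℝ} (hρ : ∀ r : ℝ, 0 ≤ r → IsRadius 2 r (ρ r)) {r : ℝ} (hr : 0 ≤ r) :
    ρ r = Real.arccos (Real.exp (-r ^ 2 / 2)) := by
  have hG : Real.Gamma ((2 + 1) / 2) = √Real.pi / 2 := by
    rw [show ((2 : ℝ) + 1) / 2 = 1 / 2 + 1 by norm_num, Real.Gamma_add_one (by norm_num),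
      Real.Gamma_one_half_eq]
    ring
  have hs : √Real.pi ≠ 0 := by positivity
  obtain ⟨hm, h⟩ := hρ r hr
  -- Since `Γ(3/2) = √π / 2`, the coefficient is 1 and the equation reads `1 - cos ρ = 1 - exp (-r²
  -- / 2)`.
  simp only [Nat.add_one_sub_one, pow_one, integral_sin, Real.cos_zero, Nat.cast_ofNat, hG,
    div_self (two_ne_zero' ℝ), incGamma_one, mul_div_cancel₀ _ (two_ne_zero' ℝ), div_self hs,
    one_mul] at h
  rw [neg_div, ← show Real.cos (ρ r) = Real.exp (-(r ^ 2 / 2)) by linarith,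
    Real.arccos_cos hm.1 (by linarith [hm.2, Real.pi_pos])]

theorem cubeMap_two {ρ : ℝ → ℝ} (hρ : ∀ r : ℝ, 0 ≤ r → IsRadius 2 r (ρ r)) (x : unitCube 2) :
    cubeMap 2 ρ x = affine ((√(Real.exp (‖cubeToEuclidean 2 x‖ ^ 2) - 1) /
      ‖cubeToEuclidean 2 x‖) • cubeToEuclidean 2 x) := by
  rw [cubeMap_eq two_pos hρ]
  simp only [Function.comp_apply, radialMap]
  rw [radius_two hρ (norm_nonneg _), Real.tan_arccos]
  congr 3
  -- With this `a`, what remains is `√(1 - a²) / a = √(a⁻² - 1)`.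
  set a := Real.exp (-‖cubeToEuclidean 2 x‖ ^ 2 / 2) with ha
  have ha0 : 0 < a := Real.exp_pos _
  have h : Real.exp (‖cubeToEuclidean 2 x‖ ^ 2) - 1 = (1 - a ^ 2) / a ^ 2 := by
    have h2 : Real.exp (‖cubeToEuclidean 2 x‖ ^ 2) * a ^ 2 = 1 := by
      rw [ha, ← Real.exp_nat_mul, ← Real.exp_add, Real.exp_eq_one_iff]
      push_cast
      ring
    field_simp
    linarith
  rw [h, Real.sqrt_div' _ (by positivity), Real.sqrt_sq ha0.le]

end RP

theorem corollary3p2 :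
    (∀ n : ℕ, 0 < n →
      RP.riemannianVolume n univ =
          ENNReal.ofReal (Real.pi ^ (((n : ℝ) + 1) / 2) / Real.Gamma (((n : ℝ) + 1) / 2)) ∧
      (∀ r : ℝ, 0 ≤ r → ∃! s : ℝ, RP.IsRadius n r s) ∧
      ∀ ρ : ℝ → ℝ, (∀ r : ℝ, 0 ≤ r → RP.IsRadius n r (ρ r)) →
        (MeasurableEmbedding (RP.radialMap (n := n) ρ) ∧
          range (RP.radialMap (n := n) ρ) = Metric.ball 0 (Real.pi / 2) ∧
          MeasurePreserving (RP.radialMap (n := n) ρ) (gaussianEuclidean n 1)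
            (radialMeasure n (Real.pi / 2) (RP.weight n))) ∧
        (MeasurableEmbedding (RP.cubeMap n ρ) ∧
          range (RP.cubeMap n ρ) = (RP.hyperplane n)ᶜ ∧
          RP.unif n (RP.hyperplane n) = 0 ∧
          MeasurePreserving (RP.cubeMap n ρ) (cubeUnif n) (RP.unif n))) ∧
    (∀ ρ : ℝ → ℝ, (∀ r : ℝ, 0 ≤ r → RP.IsRadius 1 r (ρ r)) →
      (∀ r : ℝ, 0 ≤ r →
        ρ r = √Real.pi / 2 * incGamma (1 / 2) (r ^ 2 / 2) ∧
        ρ r = Real.pi / 2 * erf (r / √2)) ∧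
      ∀ x : unitCube 1, RP.cubeMap 1 ρ x = RP.affine !₂[-Real.cot (Real.pi * x.1 0)]) ∧
    (∀ ρ : ℝ → ℝ, (∀ r : ℝ, 0 ≤ r → RP.IsRadius 2 r (ρ r)) →
      (∀ r : ℝ, 0 ≤ r → ρ r = Real.arccos (Real.exp (-r ^ 2 / 2))) ∧
      ∀ x : unitCube 2, RP.cubeMap 2 ρ x =
        RP.affine ((√(Real.exp (‖cubeToEuclidean 2 x‖ ^ 2) - 1) / ‖cubeToEuclidean 2 x‖) •
          cubeToEuclidean 2 x)) := by
  refine ⟨fun n hn => ⟨RP.riemannianVolume_univ hn, fun r _ => RP.existsUnique_isRadius hn,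
    fun ρ hρ => ⟨⟨?_, RP.range_radialMap_radius hn hρ, ?_, RP.map_radialMap_radius hn hρ⟩,
      RP.measurableEmbedding_cubeMap hn hρ, RP.range_cubeMap hn hρ, RP.unif_hyperplane n,
      RP.measurePreserving_cubeMap hn hρ⟩⟩,
    fun ρ hρ => ⟨fun r hr => RP.radius_one hρ hr, RP.cubeMap_one hρ⟩,
    fun ρ hρ => ⟨fun r hr => RP.radius_two hρ hr, RP.cubeMap_two hρ⟩⟩
  · exact RP.measurableEmbedding_radialMap (RP.radius_zero hρ) (RP.strictMonoOn_radius hn hρ)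
  · exact RP.measurable_radialMap_of_monotoneOn (RP.strictMonoOn_radius hn hρ).monotoneOn
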